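/- **Setting.** Let $m\ge 2$, and let $S$ be either an at most countable set with the discrete topology or a Euclidean space $\mathbb R^l$, with its Borel $\sigma$-field $\mathcal S$ and a $\sigma$-finite reference measure $\sigma$. Let $\Theta=\overline{\Theta^0}$ with $\Theta^0\subset\mathbb R^M$ open and bounded, and let $\bar O$ be the closure of an open bounded set $O\subset\mathbb R^d$. For $\theta\in\Theta$ let $P_\theta=(p_{ij}(\theta))_{1\le i,j\le m}$ be a stochastic matrix and $\beta_1(\theta),\dots,\beta_m(\theta)$ signal parameters; for $\beta\in\bar O$ let $q_\beta(dy)=q_\beta(y)\,\sigma(dy)$ be a probability measure on $S$ with a given measurable density $q_\beta(y)\in[0,\infty)$. For $\theta\in\Theta$ and a probability vector $\nu$ on $\{1,\dots,m\}$, under $\mathbb P_{\theta,\nu}$ the process $(X_n)_{n\ge0}$ is a Markov chain on $\{1,\dots,m\}$ with transition matrix $P_\theta$ and initial law $\nu$, and, given $X_0=x_0,\dots,X_n=x_n$, the signals $Y_0,\dots,Y_n$ are independent, $Y_k$ having law $q_{\beta_{x_k}(\theta)}$. **Assumptions.** * (H0) $\beta_i(\theta)\in\bar O$ for all $i$ and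 all $\theta\in\Theta$; the map $\theta\mapsto\big((p_{ij}(\theta))_{i,j},(\beta_i(\theta))_i\big)$ is continuous and injective on $\Theta$; the map $\beta\mapsto q_\beta$ is continuous from $\bar O$ to the probability measures on $S$ with the weak convergence topology. * (H1) There are $n_0\ge1$, $\kappa>0$ and a probability vector $\nu_0$ with $\nu_0(j)>0$ for all $j$ such that $P_\theta^{n_0}(i,j)\ge\kappa\,\nu_0(j)$ for all $\theta\in\Theta$ and all $i,j$. * (H2) The hidden states are ordered by the signal parameters: if $\theta,\theta'\in\Theta$ and a permutation $\tau$ of $\{1,\dots,m\}$ satisfy $\beta_{\tau(i)}(\theta)=\beta_i(\theta')$ for all $i$, then $\tau=\mathrm{id}$. (In particular $\beta_1(\theta),\dots,\beta_m(\theta)$ are pairwise distinct.) * (H3) If $b_i,\tilde b_i\in\bar O$ and $c_i,\tilde c_i\ge0$ ($1\le i\le m$), $\sum_ic_i=\sum_i\tilde c_i=1$ and $\sum_ic_iq_{b_i}=\sum_i\tilde c_iq_{\tilde b_i}$, then $\sum_ic_i\delta_{b_i}=\sum_i\tilde c_i\delta_{\tilde b_i}$. * (H4) For all $\beta,\beta'\in\bar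 O$ the measures $q_\beta,q_{\beta'}$ are equivalent; for $\sigma$-a.e. $y$ the map $\beta\mapsto q_\beta(y)$ is continuous on $\bar O$; and for every $\beta\in\bar O$, $\sup_{\beta'\in\bar O}\big|\log\frac{q_\beta(y)}{q_{\beta'}(y)}\big|\in L^1(q_\beta)$, the supremum being taken in $[0,\infty]$. Let $\mu_\theta$ be the invariant probability vector of $P_\theta$ (unique by (H1)) and $$Q_\theta^{Y,2}(y,y')=\sum_{i,j=1}^m\mu_\theta(i)\,p_{ij}(\theta)\,q_{\beta_i(\theta)}(y)\,q_{\beta_j(\theta)}(y'),$$ the density with respect to $\sigma(dy)\sigma(dy')$ of the stationary law of $(Y_0,Y_1)$. For $n\ge1$ a maximum entropy estimate $\hat\theta_n^{ME}$ from $Y_0,\dots,Y_n$ is a minimizer over $\theta'\in\Theta$ of $$-\frac1n\sum_{k=1}^n\log Q_{\theta'}^{Y,2}(Y_{k-1},Y_k)\qquad(-\log0=+\infty).$$ **Theorem (Strong consistency).** Assume (H0)–(H4). Then for every $\theta\in\Theta$ and every initial law $\nu$, $\mathbb P_{\theta,\nu}$-almost surely: for every $n\ge1$ a maximum entropy estimate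 exists, and every sequence $(\hat\theta_n^{ME})_{n\ge1}$ of maximum entropy estimates satisfies $\hat\theta_n^{ME}\to\theta$. -/

import Mathlib

open MeasureTheory Filter Topology
open scoped NNReal ENNReal

namespace HMM

/-- The signal space is at most countable with the discrete topology, or a Euclidean space `ℝ^l`
(up to homeomorphism; only the topology and its Borel sets are used). -/
def IsSignalSpace (S : Type*) [TopologicalSpace S] : Prop :=
  (Countable S ∧ DiscreteTopology S) ∨ ∃ l : ℕ, Nonempty (S ≃ₜ EuclideanSpace ℝ (Fin l))

/-- A parametrized family of hidden Markov models with `m` hidden states, signals in `S`, signal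
parameters in `ℝ^d` and unknown parameter in `ℝ^M`. All maps are total functions; only their values
for `θ` in `Θ = closure Θ₀` and `b` in `closure O` are ever used. -/
structure Family (m d M : ℕ) (S : Type*) [MeasurableSpace S] where
  /-- the parameter set is the closure of `Θ₀` -/
  Θ₀ : Set (EuclideanSpace ℝ (Fin M))
  isOpen_Θ₀ : IsOpen Θ₀
  isBounded_Θ₀ : Bornology.IsBounded Θ₀
  /-- the signal parameters vary in the closure of `O` -/
  O : Set (EuclideanSpace ℝ (Fin d))
  isOpen_O : IsOpen O
  isBounded_O : Bornology.IsBounded O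
  /-- transition matrix `P_θ = (p_ij(θ))` of the hidden chain -/
  p : EuclideanSpace ℝ (Fin M) → Matrix (Fin m) (Fin m) ℝ
  stochastic : ∀ θ ∈ closure Θ₀, p θ ∈ Matrix.rowStochastic ℝ (Fin m)
  /-- signal parameters `β_i(θ)` -/
  β : EuclideanSpace ℝ (Fin M) → Fin m → EuclideanSpace ℝ (Fin d)
  /-- reference measure on the signal space -/
  σ : Measure S
  sigmaFinite : SigmaFinite σ
  /-- `q b` is the density of the signal distribution `q_b` with respect to `σ` -/
  q : EuclideanSpace ℝ (Fin d) → S → ℝ≥0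
  measurable_q : ∀ b ∈ closure O, Measurable (q b)
  lintegral_q : ∀ b ∈ closure O, ∫⁻ y, (q b y : ℝ≥0∞) ∂σ = 1

namespace Family

variable {m d M : ℕ} {S : Type*} [MeasurableSpace S] (F : Family m d M S)

/-- The parameter set `Θ`. -/
def Θ : Set (EuclideanSpace ℝ (Fin M)) := closure F.Θ₀

/-- The signal distribution `q_b(y) σ(dy)`. -/
noncomputable def signal (b : EuclideanSpace ℝ (Fin d)) : Measure S :=
  F.σ.withDensity fun y => (F.q b y : ℝ≥0∞)

/-- The signal distribution as an element of the space of probability measures. -/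
noncomputable def signalPM (b : closure F.O) : ProbabilityMeasure S :=
  ⟨F.signal b, ⟨by
    rw [signal, withDensity_apply _ MeasurableSet.univ, Measure.restrict_univ]
    exact F.lintegral_q b b.2⟩⟩

/-- (H0), beyond what is built into `Family`; the topology on `ProbabilityMeasure S` is that of
weak convergence. -/
structure H0 [TopologicalSpace S] [BorelSpace S] : Prop where
  beta_mem : ∀ θ ∈ F.Θ, ∀ i, F.β θ i ∈ closure F.O
  continuousOn : ContinuousOn (fun θ => (F.p θ, F.β θ)) F.Θ
  injOn : Set.InjOn (fun θ => (F.p θ, F.β θ)) F.Θ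
  continuous_signal : Continuous F.signalPM

/-- (H1): uniform Doeblin condition for the hidden chain. -/
def H1 : Prop :=
  ∃ n₀ : ℕ, 1 ≤ n₀ ∧ ∃ κ : ℝ, 0 < κ ∧ ∃ ν₀ ∈ stdSimplex ℝ (Fin m), (∀ j, 0 < ν₀ j) ∧
    ∀ θ ∈ F.Θ, ∀ i j, κ * ν₀ j ≤ (F.p θ ^ n₀) i j

/-- (H2): the hidden states are ordered by the signal parameters, that is, the labelling of the
states is determined by the values of the signal parameters. The case `θ' = θ` says that these are
pairwise distinct. -/
def H2 : Prop :=
  ∀ θ ∈ F.Θ, ∀ θ' ∈ F.Θ, ∀ τ : Equiv.Perm (Fin m),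
    (∀ i, F.β θ (τ i) = F.β θ' i) → ∀ i, τ i = i

/-- (H3): identifiability of mixtures of `m` signal distributions. -/
def H3 : Prop :=
  ∀ (b b' : Fin m → EuclideanSpace ℝ (Fin d)) (c c' : Fin m → ℝ≥0),
    (∀ i, b i ∈ closure F.O) → (∀ i, b' i ∈ closure F.O) → ∑ i, c i = 1 → ∑ i, c' i = 1 →
    ∑ i, c i • F.signal (b i) = ∑ i, c' i • F.signal (b' i) →
    ∑ i, c i • Measure.dirac (b i) = ∑ i, c' i • Measure.dirac (b' i)

/-- (H4): equivalence, continuity of the densities, and integrability of the supremum of the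
absolute log-likelihood ratios, taken in `[0, ∞]` (so that `|log (a / 0)| = ∞` for `a > 0`). -/
structure H4 : Prop where
  equivalent : ∀ b ∈ closure F.O, ∀ b' ∈ closure F.O, F.signal b ≪ F.signal b'
  continuous_density : ∀ᵐ y ∂F.σ, ContinuousOn (fun b => F.q b y) (closure F.O)
  integrable_log : ∀ b ∈ closure F.O,
    ∫⁻ y, ⨆ b' ∈ closure F.O, (ENNReal.log ((F.q b y : ℝ≥0∞) / (F.q b' y : ℝ≥0∞))).abs
      ∂(F.signal b) < ∞

/-- `(X_n, Y_n)` is, under `ℙ`, the hidden Markov model with parameter `θ` and initial law `ν` of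
`X_0`: `X` is a Markov chain with initial law `ν` and transition matrix `P_θ`, and given
`X_0 = x_0, …, X_n = x_n` the signals `Y_0, …, Y_n` are independent, `Y_k` with law
`q_{β_i(θ)}`, `i = x_k`. -/
structure IsHMM (θ : EuclideanSpace ℝ (Fin M)) (ν : Fin m → ℝ) {Ω : Type*} [MeasurableSpace Ω]
    (ℙ : Measure Ω) (X : ℕ → Ω → Fin m) (Y : ℕ → Ω → S) : Prop where
  measurable_state : ∀ n, Measurable (X n)
  measurable_signal : ∀ n, Measurable (Y n)
  law_state : ∀ (n : ℕ) (x : ℕ → Fin m),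
    ℙ {ω | ∀ k ≤ n, X k ω = x k} =
      ENNReal.ofReal (ν (x 0) * ∏ k ∈ Finset.range n, F.p θ (x k) (x (k + 1)))
  law_signal : ∀ (n : ℕ) (x : ℕ → Fin m) (A : ℕ → Set S), (∀ k, MeasurableSet (A k)) →
    ℙ {ω | (∀ k ≤ n, X k ω = x k) ∧ ∀ k ≤ n, Y k ω ∈ A k} =
      ℙ {ω | ∀ k ≤ n, X k ω = x k} *
        ∏ k ∈ Finset.range (n + 1), F.signal (F.β θ (x k)) (A k)

open Classical in
/-- The invariant probability vector `μ_θ`, `μ_θ P_θ = μ_θ`, of the hidden chain (under (H1) it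
exists and is unique for every `θ ∈ Θ`; the default value `0` plays no role). -/
noncomputable def invariantLaw (θ : EuclideanSpace ℝ (Fin M)) : Fin m → ℝ :=
  if h : ∃ μ ∈ stdSimplex ℝ (Fin m), Matrix.vecMul μ (F.p θ) = μ then h.choose else 0

/-- The density `Q_θ^{Y,2}(y, y')`, with respect to `σ(dy) σ(dy')`, of the stationary law of
`(Y_0, Y_1)`. -/
noncomputable def pairDensity (θ : EuclideanSpace ℝ (Fin M)) (y y' : S) : ℝ :=
  ∑ i, ∑ j, F.invariantLaw θ i * F.p θ i j * F.q (F.β θ i) y * F.q (F.β θ j) y'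

/-- The objective `-(1/n) ∑_{k=1}^n log Q_θ^{Y,2}(y_{k-1}, y_k)`, with `-log 0 = +∞`. -/
noncomputable def objective (n : ℕ) (y : ℕ → S) (θ : EuclideanSpace ℝ (Fin M)) : EReal :=
  -(((n : ℝ)⁻¹ : ℝ) * ∑ k ∈ Finset.Icc 1 n,
      ENNReal.log (ENNReal.ofReal (F.pairDensity θ (y (k - 1)) (y k))))

/-- `t` is a maximum entropy estimate from the observations `y_0, …, y_n`: a minimizer over `Θ`
of the objective. -/
def IsMEE (n : ℕ) (y : ℕ → S) (t : EuclideanSpace ℝ (Fin M)) : Prop :=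
  t ∈ F.Θ ∧ IsMinOn (F.objective n y) F.Θ t

end Family

end HMM

/-!
The objective is, up to a term not depending on the parameter, minus the mean log-likelihood ratio
`A_n(t) = (1/n) ∑ log (Q_t(Y_{k-1}, Y_k) / Q_θ(Y_{k-1}, Y_k))`, so that maximum entropy estimates are
the maximizers of `A_n` over the compact set `Θ`. The log-ratio, unlike `log Q_t`, is dominated
by an integrable function, the oscillation of (H4) in each of the two signals. Almost surely all
signals are regular (all densities positive and continuous in the parameter), and then `A_n` is a
continuous function on `Θ`; this gives the existence of the estimates.

For consistency, `A_n` is regarded as a mean of random elements of the Banach space `C(Θ, ℝ)`. The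
strong law `Family.IsHMM.ae_tendsto_average` for functions of consecutive signals yields uniform
convergence of `A_n` to the mean `L(t)` of the log-likelihood ratio under the stationary law of
`(Y_0, Y_1)` for `θ`. Now `L(θ) = 0`, and `L(t) < 0` for `t ≠ θ`: by
`Family.pairLaw_eq_of_integral_nonneg`, `L(t) ≥ 0` forces the pair laws to agree, and
`Family.eq_of_pairLaw_eq` recovers the parameter from the pair law. Maximizers of `A_n` thus converge
to the unique maximizer `θ` of `L` (`tendsto_of_isMax`).

The strong law has two ingredients. The signals have the law of those read off along the hidden path
from a table of independent variables, one for each time and hidden state (`Family.IsHMM.map_eq`).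
For a fixed path, the transitions from `i` to `j` at times of a given parity use disjoint entries of
the table, so that the strong law for i.i.d. sequences replaces each term by its conditional mean
given the hidden transition (`ae_tendsto_average_of_path`). The averages of these conditional means
converge by the law of large numbers for the hidden chain (`IsMarkovChain.ae_tendsto_average`), which
for an arbitrary initial law follows from Poisson's equation and the orthogonality of martingale
increments.

Identifiability applies (H3) to mixtures read off from the pair law. Its first marginal determines
the signal parameters as a set, hence with (H2) as a sequence, and the invariant law `μ`; for each
second factor `B` the measures of `A ×ˢ B` determine the numbers `∑_j μ(i) p_ij q_{β_j}(B)`; and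
these, as mixtures in `B`, determine `p_ij`, since `μ` is positive by (H1).
-/

namespace HMM

/-! ### Stochastic matrices with a positive power -/

section Stochastic

variable {ι : Type*} [Fintype ι] [DecidableEq ι] {P : Matrix ι ι ℝ}

/-- A left eigenvector `v` of `P` for the eigenvalue `1` exists because `1` is a right one, and
`|v|` is one again: `|v| ≤ |v| P` coordinatewise, while both sides have the same sum. -/
lemma exists_invariant [Nonempty ι] (hP : P ∈ Matrix.rowStochastic ℝ ι) :
    ∃ μ ∈ stdSimplex ℝ ι, Matrix.vecMul μ P = μ := by
  have hdet : (P - 1).det = 0 := by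
    rw [← Matrix.exists_mulVec_eq_zero_iff]
    exact ⟨1, one_ne_zero, by rw [Matrix.sub_mulVec, hP.2, Matrix.one_mulVec, sub_self]⟩
  obtain ⟨v, hv0, hv⟩ := Matrix.exists_vecMul_eq_zero_iff.2 hdet
  rw [Matrix.vecMul_sub, Matrix.vecMul_one, sub_eq_zero] at hv
  have hle : ∀ j, |v j| ≤ ∑ i, |v i| * P i j := fun j => by
    conv_lhs => rw [← hv]
    refine (Finset.abs_sum_le_sum_abs _ _).trans (Finset.sum_le_sum fun i _ => ?_)
    rw [abs_mul, abs_of_nonneg (hP.1 i j)]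
  have hsum : ∑ j, |v j| = ∑ j, ∑ i, |v i| * P i j := by
    rw [Finset.sum_comm]
    refine Finset.sum_congr rfl fun i _ => ?_
    rw [← Finset.mul_sum, Matrix.sum_row_of_mem_rowStochastic hP, mul_one]
  have heq := (Finset.sum_eq_sum_iff_of_le fun j _ => hle j).1 hsum
  have hpos : 0 < ∑ i, |v i| := by
    obtain ⟨i, hi⟩ := Function.ne_iff.1 hv0
    exact Finset.sum_pos' (fun i _ => abs_nonneg _) ⟨i, Finset.mem_univ _, abs_pos.2 hi⟩
  refine ⟨(∑ i, |v i|)⁻¹ • fun i => |v i|, ⟨fun i => ?_, ?_⟩, ?_⟩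
  · exact mul_nonneg (inv_nonneg.2 hpos.le) (abs_nonneg _)
  · simp only [Pi.smul_apply, smul_eq_mul, ← Finset.mul_sum]
    exact inv_mul_cancel₀ hpos.ne'
  · rw [Matrix.smul_vecMul]
    congr 1
    ext j
    exact (heq j (Finset.mem_univ j)).symm

lemma vecMul_pow_of_invariant {μ : ι → ℝ} (hμ : Matrix.vecMul μ P = μ) (n : ℕ) :
    Matrix.vecMul μ (P ^ n) = μ := by
  induction n with
  | zero => simp
  | succ n ih => rw [pow_succ, ← Matrix.vecMul_vecMul, ih, hμ]

lemma mulVec_pow_of_harmonic {g : ι → ℝ} (hg : P.mulVec g = g) (n : ℕ) :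
    (P ^ n).mulVec g = g := by
  induction n with
  | zero => simp
  | succ n ih => rw [pow_succ, ← Matrix.mulVec_mulVec, hg, ih]

lemma invariant_pos {n : ℕ} (hpos : ∀ i j, 0 < (P ^ n) i j) {μ : ι → ℝ}
    (hμ : μ ∈ stdSimplex ℝ ι) (hinv : Matrix.vecMul μ P = μ) (j : ι) : 0 < μ j := by
  have h1 : ∃ i, 0 < μ i := by
    by_contra! h
    have := Finset.sum_nonpos fun i (_ : i ∈ Finset.univ) => h i
    rw [hμ.2] at this
    linarith
  obtain ⟨i, hi⟩ := h1
  rw [← vecMul_pow_of_invariant hinv n]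
  exact Finset.sum_pos' (fun k _ => mul_nonneg (hμ.1 k) (hpos k j).le)
    ⟨i, Finset.mem_univ _, mul_pos hi (hpos i j)⟩

/-- Maximum principle: harmonic functions of an irreducible aperiodic chain are constant. -/
lemma harmonic_const (hP : P ∈ Matrix.rowStochastic ℝ ι) {n : ℕ}
    (hpos : ∀ i j, 0 < (P ^ n) i j) {g : ι → ℝ} (hg : P.mulVec g = g) (i j : ι) : g i = g j := by
  have : Nonempty ι := ⟨i⟩
  obtain ⟨k, hk⟩ := Finite.exists_max g
  have hPn := pow_mem hP n
  have h0 : ∑ l, (P ^ n) k l * (g k - g l) = 0 := by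
    have h := congrFun (mulVec_pow_of_harmonic hg n) k
    rw [Matrix.mulVec, dotProduct] at h
    simp only [mul_sub, Finset.sum_sub_distrib, h, ← Finset.sum_mul,
      Matrix.sum_row_of_mem_rowStochastic hPn, one_mul, sub_self]
  rw [Finset.sum_eq_zero_iff_of_nonneg
    fun l _ => mul_nonneg (hpos k l).le (sub_nonneg.2 (hk l))] at h0
  have h1 : ∀ l, g k = g l := fun l => by
    have := (mul_eq_zero.1 (h0 l (Finset.mem_univ l))).resolve_left (hpos k l).ne'
    linarith
  rw [← h1 i, ← h1 j]

/-- The matrix `1 - P + J`, `J` the all-ones matrix. For a stochastic matrix with a positive power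
it is invertible, and its inverse yields the invariant law and solves Poisson's equation. -/
def poissonMatrix (P : Matrix ι ι ℝ) : Matrix ι ι ℝ := 1 - P + Matrix.of fun _ _ => 1

lemma poissonMatrix_mulVec (g : ι → ℝ) :
    (poissonMatrix P).mulVec g = g - P.mulVec g + fun _ => ∑ i, g i := by
  rw [poissonMatrix, Matrix.add_mulVec, Matrix.sub_mulVec, Matrix.one_mulVec]
  congr 1
  ext i
  simp [Matrix.mulVec, dotProduct]

lemma vecMul_poissonMatrix {μ : ι → ℝ} (hμ : μ ∈ stdSimplex ℝ ι) (hinv : Matrix.vecMul μ P = μ) :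
    Matrix.vecMul μ (poissonMatrix P) = 1 := by
  rw [poissonMatrix, Matrix.vecMul_add, Matrix.vecMul_sub, Matrix.vecMul_one, hinv, sub_self,
    zero_add]
  ext i
  simp [Matrix.vecMul, dotProduct, hμ.2]

/-- If `(1 - P + J) g = h` and `μ h = 0` for an invariant law `μ`, then `g` has sum zero. -/
lemma sum_eq_zero_of_poissonMatrix {μ : ι → ℝ} (hμ : μ ∈ stdSimplex ℝ ι)
    (hinv : Matrix.vecMul μ P = μ) {g h : ι → ℝ} (hg : (poissonMatrix P).mulVec g = h)
    (hh : μ ⬝ᵥ h = 0) : ∑ i, g i = 0 := by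
  rw [← hg, Matrix.dotProduct_mulVec, vecMul_poissonMatrix hμ hinv] at hh
  simpa [dotProduct] using hh

lemma isUnit_poissonMatrix [Nonempty ι] (hP : P ∈ Matrix.rowStochastic ℝ ι) {n : ℕ}
    (hpos : ∀ i j, 0 < (P ^ n) i j) : IsUnit (poissonMatrix P) := by
  obtain ⟨μ, hμ, hinv⟩ := exists_invariant hP
  rw [Matrix.isUnit_iff_isUnit_det, isUnit_iff_ne_zero, Ne, ← Matrix.exists_mulVec_eq_zero_iff]
  rintro ⟨g, hg0, hg⟩
  have hs := sum_eq_zero_of_poissonMatrix hμ hinv hg (dotProduct_zero _)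
  have hg' : P.mulVec g = g := by
    rw [poissonMatrix_mulVec, hs] at hg
    ext i
    have := congrFun hg i
    simp only [Pi.add_apply, Pi.sub_apply, Pi.zero_apply, add_zero] at this
    linarith
  refine hg0 (funext fun i => ?_)
  rw [Finset.sum_congr rfl fun j _ => harmonic_const hP hpos hg' j i] at hs
  simpa using hs

lemma invariant_eq_vecMul_inv [Nonempty ι] (hP : P ∈ Matrix.rowStochastic ℝ ι) {n : ℕ}
    (hpos : ∀ i j, 0 < (P ^ n) i j) {μ : ι → ℝ} (hμ : μ ∈ stdSimplex ℝ ι)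
    (hinv : Matrix.vecMul μ P = μ) : μ = Matrix.vecMul 1 (poissonMatrix P)⁻¹ := by
  rw [← vecMul_poissonMatrix hμ hinv, Matrix.vecMul_vecMul, Matrix.mul_nonsing_inv _
    ((Matrix.isUnit_iff_isUnit_det _).1 (isUnit_poissonMatrix hP hpos)), Matrix.vecMul_one]

/-- Poisson's equation `g - P g = h` is solvable if `h` is centred under the invariant law. -/
lemma exists_poisson [Nonempty ι] (hP : P ∈ Matrix.rowStochastic ℝ ι) {n : ℕ}
    (hpos : ∀ i j, 0 < (P ^ n) i j) {μ : ι → ℝ} (hμ : μ ∈ stdSimplex ℝ ι)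
    (hinv : Matrix.vecMul μ P = μ) {h : ι → ℝ} (hh : μ ⬝ᵥ h = 0) :
    ∃ g : ι → ℝ, g - P.mulVec g = h := by
  have hg : (poissonMatrix P).mulVec ((poissonMatrix P)⁻¹.mulVec h) = h := by
    rw [Matrix.mulVec_mulVec, Matrix.mul_nonsing_inv _
      ((Matrix.isUnit_iff_isUnit_det _).1 (isUnit_poissonMatrix hP hpos)), Matrix.one_mulVec]
  refine ⟨(poissonMatrix P)⁻¹.mulVec h, ?_⟩
  have hs := sum_eq_zero_of_poissonMatrix hμ hinv hg hh
  rw [poissonMatrix_mulVec, hs] at hg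
  ext i
  simpa using congrFun hg i

lemma continuousOn_invariant [Nonempty ι] {α : Type*} [TopologicalSpace α] {s : Set α}
    {P : α → Matrix ι ι ℝ} (hP : ∀ a ∈ s, P a ∈ Matrix.rowStochastic ℝ ι)
    (hpos : ∀ a ∈ s, ∃ n : ℕ, ∀ i j, 0 < (P a ^ n) i j) (hc : ContinuousOn P s)
    {μ : α → ι → ℝ} (hμ : ∀ a ∈ s, μ a ∈ stdSimplex ℝ ι)
    (hinv : ∀ a ∈ s, Matrix.vecMul (μ a) (P a) = μ a) : ContinuousOn μ s := by
  have hJ : ContinuousOn (fun a => poissonMatrix (P a)) s :=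
    (continuousOn_const.sub hc).add continuousOn_const
  have hI : ContinuousOn (fun a => (poissonMatrix (P a))⁻¹) s := by
    have hd : Continuous fun A : Matrix ι ι ℝ => A.det := continuous_id.matrix_det
    have hadj : Continuous fun A : Matrix ι ι ℝ => A.adjugate := continuous_id.matrix_adjugate
    simp only [Matrix.inv_def, Ring.inverse_eq_inv']
    refine ((hd.comp_continuousOn hJ).inv₀ fun a ha => ?_).smul (hadj.comp_continuousOn hJ)
    obtain ⟨n, hn⟩ := hpos a ha
    exact ((Matrix.isUnit_iff_isUnit_det _).1 (isUnit_poissonMatrix (hP a ha) hn)).ne_zero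
  refine ContinuousOn.congr (f := fun a => Matrix.vecMul 1 (poissonMatrix (P a))⁻¹) ?_ fun a ha => ?_
  · have hv : Continuous fun A : Matrix ι ι ℝ => Matrix.vecMul (1 : ι → ℝ) A :=
      continuous_const.matrix_vecMul continuous_id
    exact hv.comp_continuousOn hI
  · obtain ⟨n, hn⟩ := hpos a ha
    exact invariant_eq_vecMul_inv (hP a ha) hn (hμ a ha) (hinv a ha)

end Stochastic

/-! ### Law of large numbers for a finite Markov chain -/

section AlmostSure

variable {Ω : Type*} [MeasurableSpace Ω] {ℙ : Measure Ω}

/-- Bounded increments and a linear bound on the second moment give `S n / n → 0`: the second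
moments of `S (n ^ 2) / n ^ 2` are summable, and the bounded increments fill the gaps. -/
lemma ae_tendsto_div_of_sq_le {S : ℕ → Ω → ℝ} (hS : ∀ n, Measurable (S n)) {C : ℝ}
    (hinc : ∀ n ω, |S (n + 1) ω - S n ω| ≤ C)
    (hsq : ∀ n : ℕ, ∫⁻ ω, ENNReal.ofReal (S n ω ^ 2) ∂ℙ ≤ ENNReal.ofReal (C ^ 2 * n)) :
    ∀ᵐ ω ∂ℙ, Tendsto (fun n : ℕ => S n ω / n) atTop (𝓝 0) := by
  have hsum : ∫⁻ ω, ∑' n : ℕ,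
      ENNReal.ofReal ((S ((n + 1) ^ 2) ω / ((n + 1) ^ 2 : ℕ)) ^ 2) ∂ℙ ≠ ∞ := by
    rw [lintegral_tsum fun n => (((hS _).div_const _).pow_const 2).ennreal_ofReal.aemeasurable]
    have hb : ∀ n : ℕ, ∫⁻ ω, ENNReal.ofReal ((S ((n + 1) ^ 2) ω / ((n + 1) ^ 2 : ℕ)) ^ 2) ∂ℙ
        ≤ ENNReal.ofReal (C ^ 2 * (1 / ((n + 1 : ℕ) : ℝ) ^ 2)) := fun n => by
      have hn : (0 : ℝ) < ((n + 1 : ℕ) : ℝ) := by positivity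
      calc ∫⁻ ω, ENNReal.ofReal ((S ((n + 1) ^ 2) ω / ((n + 1) ^ 2 : ℕ)) ^ 2) ∂ℙ
          = ∫⁻ ω, ENNReal.ofReal ((((n + 1 : ℕ) : ℝ) ^ 4)⁻¹)
              * ENNReal.ofReal (S ((n + 1) ^ 2) ω ^ 2) ∂ℙ := by
            refine lintegral_congr fun ω => ?_
            rw [← ENNReal.ofReal_mul (by positivity)]
            congr 1
            push_cast
            field_simp
        _ = ENNReal.ofReal ((((n + 1 : ℕ) : ℝ) ^ 4)⁻¹)
              * ∫⁻ ω, ENNReal.ofReal (S ((n + 1) ^ 2) ω ^ 2) ∂ℙ :=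
            lintegral_const_mul' _ _ ENNReal.ofReal_ne_top
        _ ≤ ENNReal.ofReal ((((n + 1 : ℕ) : ℝ) ^ 4)⁻¹)
              * ENNReal.ofReal (C ^ 2 * ((n + 1) ^ 2 : ℕ)) := by gcongr; exact hsq _
        _ = _ := by
            rw [← ENNReal.ofReal_mul (by positivity)]
            congr 1
            push_cast
            field_simp
    refine ne_top_of_le_ne_top ?_ (ENNReal.tsum_le_tsum hb)
    refine Summable.tsum_ofReal_ne_top (Summable.mul_left _ ?_)
    exact (summable_nat_add_iff 1).2 (Real.summable_one_div_nat_pow.2 one_lt_two)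
  have hmeas : Measurable fun ω => ∑' n : ℕ,
      ENNReal.ofReal ((S ((n + 1) ^ 2) ω / ((n + 1) ^ 2 : ℕ)) ^ 2) :=
    Measurable.tsum fun n => (((hS _).div_const _).pow_const 2).ennreal_ofReal
  filter_upwards [ae_lt_top hmeas hsum] with ω hω
  have h1 : Tendsto (fun n : ℕ => S ((n + 1) ^ 2) ω / ((n + 1) ^ 2 : ℕ)) atTop (𝓝 0) := by
    have h2 := ENNReal.tendsto_atTop_zero_of_tsum_ne_top hω.ne
    have h3 := (ENNReal.tendsto_toReal ENNReal.zero_ne_top).comp h2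
    simp only [Function.comp_def, ENNReal.toReal_ofReal (sq_nonneg _), ENNReal.toReal_zero] at h3
    rw [tendsto_zero_iff_abs_tendsto_zero]
    have h4 := (Real.continuous_sqrt.tendsto 0).comp h3
    simpa only [Function.comp_def, Real.sqrt_sq_eq_abs, Real.sqrt_zero] using h4
  -- `S n + C n` is monotone, so that convergence along the squares suffices
  have hmono : Monotone fun n : ℕ => S n ω + C * n := monotone_nat_of_le_succ fun n => by
    have := (abs_le.1 (hinc n ω)).1
    push_cast
    linarith
  have hdiv : ∀ n : ℕ, n ≠ 0 → (S n ω + C * n) / n = S n ω / n + C := fun n hn => by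
    have : (n : ℝ) ≠ 0 := Nat.cast_ne_zero.2 hn
    field_simp
  have h5 := tendsto_div_of_monotone_of_exists_subseq_tendsto_div _ C hmono fun a ha => by
    refine ⟨fun n => (n + 1) ^ 2, ?_, ?_, ?_⟩
    · have h6 : Tendsto (fun n : ℕ => (1 + 1 / ((n : ℝ) + 1)) ^ 2) atTop (𝓝 ((1 + 0) ^ 2)) :=
        (tendsto_one_div_add_atTop_nhds_zero_nat.const_add 1).pow 2
      filter_upwards [h6.eventually (ge_mem_nhds (by simpa using ha))] with n hn
      have h7 : ((n : ℝ) + 1 + 1) ^ 2 = (1 + 1 / ((n : ℝ) + 1)) ^ 2 * ((n : ℝ) + 1) ^ 2 := by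
        field_simp
      push_cast
      rw [h7]
      gcongr
    · exact tendsto_atTop_mono (fun n => by nlinarith : ∀ n : ℕ, n ≤ (n + 1) ^ 2) tendsto_id
    · have := h1.add_const C
      rw [zero_add] at this
      exact this.congr fun n => (hdiv _ (by positivity)).symm
  have h8 := h5.sub_const C
  rw [sub_self] at h8
  refine h8.congr' ?_
  filter_upwards [eventually_ne_atTop 0] with n hn
  rw [hdiv n hn, add_sub_cancel_right]

end AlmostSure

/-- `X` is under `ℙ` a Markov chain with transition matrix `P` and initial law `ν`. -/
structure IsMarkovChain {ι : Type*} [MeasurableSpace ι] (P : Matrix ι ι ℝ) (ν : ι → ℝ)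
    {Ω : Type*} [MeasurableSpace Ω] (ℙ : Measure Ω) (X : ℕ → Ω → ι) : Prop where
  measurable : ∀ n, Measurable (X n)
  law : ∀ (n : ℕ) (x : ℕ → ι), ℙ {ω | ∀ k ≤ n, X k ω = x k} =
      ENNReal.ofReal (ν (x 0) * ∏ k ∈ Finset.range n, P (x k) (x (k + 1)))

section Chain

variable {ι : Type*} [MeasurableSpace ι] {P : Matrix ι ι ℝ} {ν : ι → ℝ} {Ω : Type*}
  [MeasurableSpace Ω] {ℙ : Measure Ω} {X : ℕ → Ω → ι}

/-- The path `(X 0, …, X n)`. -/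
def history (X : ℕ → Ω → ι) (n : ℕ) (ω : Ω) : Fin (n + 1) → ι := fun k => X k ω

lemma measurable_history (hX : ∀ n, Measurable (X n)) (n : ℕ) : Measurable (history X n) :=
  measurable_pi_lambda _ fun k => hX k

variable [Fintype ι] [DecidableEq ι]

/-- The Markov property, conditioning on the whole path. -/
lemma IsMarkovChain.real_history_succ (hX : IsMarkovChain P ν ℙ X)
    (hP : P ∈ Matrix.rowStochastic ℝ ι) (hν : ∀ i, 0 ≤ ν i) (n : ℕ) (h : Fin (n + 1) → ι) (j : ι) :
    ℙ.real {ω | history X n ω = h ∧ X (n + 1) ω = j} =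
      ℙ.real {ω | history X n ω = h} * P (h (Fin.last n)) j := by
  -- the path `h` continued by the constant sequence `j`
  let x : ℕ → ι := fun k => if hk : k < n + 1 then h ⟨k, hk⟩ else j
  have hhist : ∀ ω, history X n ω = h ↔ ∀ k ≤ n, X k ω = x k := fun ω => by
    simp only [funext_iff, history, x]
    constructor
    · intro H k hk
      rw [dif_pos (Nat.lt_succ_of_le hk)]
      exact H ⟨k, Nat.lt_succ_of_le hk⟩
    · intro H k
      have := H k (Nat.lt_succ_iff.1 k.2)
      rwa [dif_pos k.2] at this
  have h1 : {ω | history X n ω = h ∧ X (n + 1) ω = j} = {ω | ∀ k ≤ n + 1, X k ω = x k} := by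
    ext ω
    simp only [Set.mem_ofPred_eq, hhist]
    constructor
    · rintro ⟨H, H'⟩ k hk
      rcases Nat.le_succ_iff.1 hk with hk | rfl
      · exact H k hk
      · simpa [x] using H'
    · intro H
      exact ⟨fun k hk => H k (by omega), by simpa [x] using H (n + 1) le_rfl⟩
  have h2 : {ω | history X n ω = h} = {ω | ∀ k ≤ n, X k ω = x k} := by
    ext ω; exact hhist ω
  have h3 : ∀ N, 0 ≤ ν (x 0) * ∏ k ∈ Finset.range N, P (x k) (x (k + 1)) := fun N =>
    mul_nonneg (hν _) (Finset.prod_nonneg fun k _ => hP.1 _ _)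
  have h4 : P (x n) (x (n + 1)) = P (h (Fin.last n)) j := by
    simp [x, Fin.last]
  rw [h1, h2, measureReal_def, measureReal_def, hX.law, hX.law, ENNReal.toReal_ofReal (h3 _),
    ENNReal.toReal_ofReal (h3 _), Finset.prod_range_succ, h4, mul_assoc]

variable [MeasurableSingletonClass ι]

/-- If `G` has mean zero under each row of `P`, then `G (X n) (X (n + 1))` is orthogonal to all
functions of the path `(X 0, …, X n)`. -/
lemma IsMarkovChain.integral_history_mul_eq_zero [IsProbabilityMeasure ℙ]
    (hX : IsMarkovChain P ν ℙ X)
    (hP : P ∈ Matrix.rowStochastic ℝ ι) (hν : ∀ i, 0 ≤ ν i) {G : ι → ι → ℝ}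
    (hG : ∀ i, ∑ j, P i j * G i j = 0) (n : ℕ) (φ : (Fin (n + 1) → ι) → ℝ) :
    ∫ ω, φ (history X n ω) * G (X n ω) (X (n + 1) ω) ∂ℙ = 0 := by
  have hm : Measurable fun ω => (history X n ω, X (n + 1) ω) :=
    (measurable_history hX.measurable n).prodMk (hX.measurable _)
  have h1 := integral_map (μ := ℙ) hm.aemeasurable
    (f := fun z : (Fin (n + 1) → ι) × ι => φ z.1 * G (z.1 (Fin.last n)) z.2)
    (measurable_of_countable _).aestronglyMeasurable
  have : IsProbabilityMeasure (ℙ.map fun ω => (history X n ω, X (n + 1) ω)) :=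
    Measure.isProbabilityMeasure_map hm.aemeasurable
  refine Eq.trans ?_ (h1.symm.trans ?_)
  · rfl
  rw [integral_fintype Integrable.of_finite, Fintype.sum_prod_type]
  refine Finset.sum_eq_zero fun h _ => ?_
  have h2 : ∀ j, (ℙ.map fun ω => (history X n ω, X (n + 1) ω)).real {(h, j)} =
      ℙ.real {ω | history X n ω = h} * P (h (Fin.last n)) j := fun j => by
    rw [map_measureReal_apply hm (measurableSet_singleton _),
      ← hX.real_history_succ hP hν n h j]
    congr 1
    ext ω
    simp
  simp only [h2, smul_eq_mul]
  rw [← mul_zero (ℙ.real {ω | history X n ω = h} * φ h), ← hG (h (Fin.last n)), Finset.mul_sum]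
  exact Finset.sum_congr rfl fun j _ => by ring

end Chain

section ChainLLN

variable {ι : Type*} [Fintype ι] [MeasurableSpace ι] [MeasurableSingletonClass ι]
  {P : Matrix ι ι ℝ} {ν : ι → ℝ} {Ω : Type*} [MeasurableSpace Ω] {ℙ : Measure Ω}
  {X : ℕ → Ω → ι}

lemma IsMarkovChain.measurable_sum (hX : IsMarkovChain P ν ℙ X) (G : ι → ι → ℝ) (n : ℕ) :
    Measurable fun ω => ∑ k ∈ Finset.range n, G (X k ω) (X (k + 1) ω) :=
  Finset.measurable_sum _ fun k _ =>
    (measurable_of_countable fun z : ι × ι => G z.1 z.2).comp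
      ((hX.measurable k).prodMk (hX.measurable (k + 1)))

variable [DecidableEq ι] [IsProbabilityMeasure ℙ]

lemma IsMarkovChain.integral_sq_sum_le (hX : IsMarkovChain P ν ℙ X)
    (hP : P ∈ Matrix.rowStochastic ℝ ι) (hν : ∀ i, 0 ≤ ν i) {G : ι → ι → ℝ}
    (hG : ∀ i, ∑ j, P i j * G i j = 0) {C : ℝ} (hC : ∀ i j, |G i j| ≤ C) (n : ℕ) :
    ∫ ω, (∑ k ∈ Finset.range n, G (X k ω) (X (k + 1) ω)) ^ 2 ∂ℙ ≤ C ^ 2 * n := by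
  have hmD : ∀ n, Measurable fun ω => G (X n ω) (X (n + 1) ω) := fun n =>
    (measurable_of_countable fun z : ι × ι => G z.1 z.2).comp
      ((hX.measurable n).prodMk (hX.measurable (n + 1)))
  have hb : ∀ n ω, |∑ k ∈ Finset.range n, G (X k ω) (X (k + 1) ω)| ≤ n * C := fun n ω => by
    refine (Finset.abs_sum_le_sum_abs _ _).trans
      ((Finset.sum_le_sum fun k _ => hC (X k ω) (X (k + 1) ω)).trans ?_)
    simp
  induction n with
  | zero => simp
  | succ n ih =>
    let φ : (Fin (n + 1) → ι) → ℝ := fun h => ∑ k : Fin n, G (h k.castSucc) (h k.succ)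
    have hφ : ∀ ω, ∑ k ∈ Finset.range n, G (X k ω) (X (k + 1) ω) = φ (history X n ω) := fun ω => by
      rw [Finset.sum_range]
      rfl
    have h0 := hX.integral_history_mul_eq_zero hP hν hG n φ
    simp only [← hφ] at h0
    have hC' : ∀ ω, 0 ≤ C := fun ω => (abs_nonneg _).trans (hC (X 0 ω) (X 0 ω))
    have i1 : Integrable (fun ω => (∑ k ∈ Finset.range n, G (X k ω) (X (k + 1) ω)) ^ 2) ℙ :=
      Integrable.of_bound ((hX.measurable_sum G n).pow_const 2).aestronglyMeasurable
        ((n * C) ^ 2) (ae_of_all _ fun ω => by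
          rw [Real.norm_eq_abs, abs_pow]
          exact pow_le_pow_left₀ (abs_nonneg _) (hb n ω) 2)
    have i2 : Integrable (fun ω => (∑ k ∈ Finset.range n, G (X k ω) (X (k + 1) ω)) *
        G (X n ω) (X (n + 1) ω)) ℙ :=
      Integrable.of_bound ((hX.measurable_sum G n).mul (hmD n)).aestronglyMeasurable
        (n * C * C) (ae_of_all _ fun ω => by
          rw [Real.norm_eq_abs, abs_mul]
          exact mul_le_mul (hb n ω) (hC _ _) (abs_nonneg _)
            (mul_nonneg n.cast_nonneg (hC' ω)))
    have i3 : Integrable (fun ω => G (X n ω) (X (n + 1) ω) ^ 2) ℙ :=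
      Integrable.of_bound ((hmD n).pow_const 2).aestronglyMeasurable
        (C ^ 2) (ae_of_all _ fun ω => by
          rw [Real.norm_eq_abs, abs_pow]
          exact pow_le_pow_left₀ (abs_nonneg _) (hC _ _) 2)
    have h3 : ∫ ω, G (X n ω) (X (n + 1) ω) ^ 2 ∂ℙ ≤ C ^ 2 := by
      refine (integral_mono i3 (integrable_const (C ^ 2)) fun ω => ?_).trans (by simp)
      rw [← sq_abs]
      exact pow_le_pow_left₀ (abs_nonneg _) (hC _ _) 2
    have h4 : ∀ ω, (∑ k ∈ Finset.range (n + 1), G (X k ω) (X (k + 1) ω)) ^ 2 =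
        (∑ k ∈ Finset.range n, G (X k ω) (X (k + 1) ω)) ^ 2 +
        2 * ((∑ k ∈ Finset.range n, G (X k ω) (X (k + 1) ω)) * G (X n ω) (X (n + 1) ω)) +
        G (X n ω) (X (n + 1) ω) ^ 2 := fun ω => by
      rw [Finset.sum_range_succ]
      ring
    have h5 := (integral_add (i1.add (i2.const_mul 2)) i3).trans
      (congrArg (· + _) (integral_add i1 (i2.const_mul 2)))
    rw [integral_const_mul, h0] at h5
    refine ((integral_congr_ae (ae_of_all _ h4)).trans h5).le.trans ?_
    push_cast
    linarith

lemma IsMarkovChain.ae_tendsto_sum_div_zero (hX : IsMarkovChain P ν ℙ X)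
    (hP : P ∈ Matrix.rowStochastic ℝ ι) (hν : ∀ i, 0 ≤ ν i) {G : ι → ι → ℝ}
    (hG : ∀ i, ∑ j, P i j * G i j = 0) :
    ∀ᵐ ω ∂ℙ, Tendsto (fun n : ℕ => (∑ k ∈ Finset.range n, G (X k ω) (X (k + 1) ω)) / n)
      atTop (𝓝 0) := by
  obtain ⟨C, hC⟩ : ∃ C, ∀ i j, |G i j| ≤ C := by
    obtain ⟨C, hC⟩ := (Set.finite_range fun z : ι × ι => |G z.1 z.2|).bddAbove
    exact ⟨C, fun i j => hC ⟨(i, j), rfl⟩⟩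
  refine ae_tendsto_div_of_sq_le (C := C) (hX.measurable_sum G) (fun n ω => ?_) fun n => ?_
  · rw [Finset.sum_range_succ, add_sub_cancel_left]
    exact hC _ _
  · rw [← ofReal_integral_eq_lintegral_ofReal]
    · exact ENNReal.ofReal_le_ofReal (hX.integral_sq_sum_le hP hν hG hC n)
    · refine Integrable.of_bound ((hX.measurable_sum G n).pow_const 2).aestronglyMeasurable
        ((n * C) ^ 2) (ae_of_all _ fun ω => ?_)
      rw [Real.norm_eq_abs, abs_pow]
      refine pow_le_pow_left₀ (abs_nonneg _) ((Finset.abs_sum_le_sum_abs _ _).trans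
        ((Finset.sum_le_sum fun k _ => hC (X k ω) (X (k + 1) ω)).trans ?_)) 2
      simp
    · exact ae_of_all _ fun ω => sq_nonneg _

/-- Poisson's equation turns the centred additive functional into a sum of orthogonal increments
plus a bounded remainder. -/
lemma IsMarkovChain.ae_tendsto_sum_div (hX : IsMarkovChain P ν ℙ X)
    (hP : P ∈ Matrix.rowStochastic ℝ ι) (hν : ∀ i, 0 ≤ ν i)
    {N : ℕ} (hpos : ∀ i j, 0 < (P ^ N) i j) {μ : ι → ℝ} (hμ : μ ∈ stdSimplex ℝ ι)
    (hinv : Matrix.vecMul μ P = μ) (f : ι → ι → ℝ) :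
    ∀ᵐ ω ∂ℙ, Tendsto (fun n : ℕ => (∑ k ∈ Finset.range n, f (X k ω) (X (k + 1) ω)) / n)
      atTop (𝓝 (∑ i, ∑ j, μ i * P i j * f i j)) := by
  set c := ∑ i, ∑ j, μ i * P i j * f i j with hc
  have : Nonempty ι := by
    obtain ⟨ω⟩ := ℙ.nonempty_of_neZero
    exact ⟨X 0 ω⟩
  obtain ⟨g, hg⟩ := exists_poisson hP hpos hμ hinv (h := fun i => ∑ j, P i j * f i j - c) (by
    simp only [dotProduct, mul_sub, Finset.sum_sub_distrib, ← Finset.sum_mul, hμ.2, one_mul]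
    rw [hc, sub_eq_zero]
    simp only [Finset.mul_sum, mul_assoc])
  have hG : ∀ i, ∑ j, P i j * (f i j - c + g j - g i) = 0 := fun i => by
    have h := congrFun hg i
    simp only [Pi.sub_apply, Matrix.mulVec, dotProduct] at h
    simp only [mul_sub, mul_add, Finset.sum_sub_distrib, Finset.sum_add_distrib,
      ← Finset.sum_mul, Matrix.sum_row_of_mem_rowStochastic hP, one_mul]
    linarith
  obtain ⟨C, hC⟩ : ∃ C, ∀ i, |g i| ≤ C := by
    obtain ⟨C, hC⟩ := (Set.finite_range fun i => |g i|).bddAbove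
    exact ⟨C, fun i => hC ⟨i, rfl⟩⟩
  filter_upwards [hX.ae_tendsto_sum_div_zero hP hν hG] with ω hω
  have hrem : Tendsto (fun n : ℕ => (g (X 0 ω) - g (X n ω)) / n) atTop (𝓝 0) := by
    refine squeeze_zero_norm (a := fun n : ℕ => 2 * C / n) (fun n => ?_)
      (tendsto_const_div_atTop_nhds_zero_nat _)
    rw [Real.norm_eq_abs, abs_div, Nat.abs_cast]
    refine div_le_div_of_nonneg_right ?_ n.cast_nonneg
    have := abs_sub (g (X 0 ω)) (g (X n ω))
    linarith [hC (X 0 ω), hC (X n ω)]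
  have h := (hω.add hrem).add_const c
  rw [add_zero, zero_add] at h
  refine h.congr' ?_
  filter_upwards [eventually_ne_atTop 0] with n hn
  have hn' : (n : ℝ) ≠ 0 := Nat.cast_ne_zero.2 hn
  have hs : ∑ k ∈ Finset.range n, (f (X k ω) (X (k + 1) ω) - c + g (X (k + 1) ω) - g (X k ω)) =
      ∑ k ∈ Finset.range n, f (X k ω) (X (k + 1) ω) - n * c + (g (X n ω) - g (X 0 ω)) := by
    rw [← Finset.sum_range_sub (fun k => g (X k ω))]
    simp only [add_sub_assoc, Finset.sum_add_distrib, Finset.sum_sub_distrib, Finset.sum_const,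
      Finset.card_range, nsmul_eq_mul]
  rw [hs]
  field_simp
  ring

/-- Law of large numbers for vector-valued functions of the transitions of a finite chain. -/
lemma IsMarkovChain.ae_tendsto_average {E : Type*} [NormedAddCommGroup E] [NormedSpace ℝ E]
    (hX : IsMarkovChain P ν ℙ X)
    (hP : P ∈ Matrix.rowStochastic ℝ ι) (hν : ∀ i, 0 ≤ ν i)
    {N : ℕ} (hpos : ∀ i j, 0 < (P ^ N) i j) {μ : ι → ℝ} (hμ : μ ∈ stdSimplex ℝ ι)
    (hinv : Matrix.vecMul μ P = μ) (f : ι → ι → E) :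
    ∀ᵐ ω ∂ℙ, Tendsto
      (fun n : ℕ => (n : ℝ)⁻¹ • ∑ k ∈ Finset.range n, f (X k ω) (X (k + 1) ω))
      atTop (𝓝 (∑ i, ∑ j, (μ i * P i j) • f i j)) := by
  have h : ∀ᵐ ω ∂ℙ, ∀ i j, Tendsto (fun n : ℕ => (∑ k ∈ Finset.range n,
      if X k ω = i ∧ X (k + 1) ω = j then (1 : ℝ) else 0) / n) atTop (𝓝 (μ i * P i j)) := by
    rw [ae_all_iff]
    intro i
    rw [ae_all_iff]
    intro j
    have := hX.ae_tendsto_sum_div hP hν hpos hμ hinv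
      fun i' j' => if i' = i ∧ j' = j then (1 : ℝ) else 0
    simpa [ite_and] using this
  filter_upwards [h] with ω hω
  refine (tendsto_finsetSum _ fun i _ => tendsto_finsetSum _ fun j _ =>
    (hω i j).smul_const (f i j)).congr fun n => ?_
  simp only [div_eq_inv_mul, mul_smul, ← Finset.smul_sum, Finset.sum_smul]
  congr 1
  calc _ = ∑ k ∈ Finset.range n, ∑ i, ∑ j,
        (if X k ω = i ∧ X (k + 1) ω = j then (1 : ℝ) else 0) • f i j := by
        rw [Finset.sum_comm]
        simp only [Finset.sum_comm (s := Finset.range n)]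
        rw [Finset.sum_comm]
    _ = _ := by simp [ite_and]

end ChainLLN

/-! ### The strong law along subsequences and for independent signals -/

section Averages

variable {E : Type*} [NormedAddCommGroup E] [NormedSpace ℝ E]

lemma tendsto_inv_smul_comp {B : ℕ → E} (hB0 : B 0 = 0)
    (hB : Tendsto (fun n : ℕ => (n : ℝ)⁻¹ • B n) atTop (𝓝 0)) {c : ℕ → ℕ} (hc : ∀ n, c n ≤ n)
    (hc' : Tendsto c atTop atTop) : Tendsto (fun n : ℕ => (n : ℝ)⁻¹ • B (c n)) atTop (𝓝 0) := by
  refine squeeze_zero_norm (fun n => ?_) (tendsto_zero_iff_norm_tendsto_zero.1 (hB.comp hc'))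
  simp only [Function.comp_apply, norm_smul, norm_inv, Real.norm_natCast]
  rcases Nat.eq_zero_or_pos (c n) with h | h
  · simp [h, hB0]
  · have := hc n
    gcongr

lemma sum_range_eq_even_add_odd {M : Type*} [AddCommMonoid M] (a : ℕ → M) (n : ℕ) :
    ∑ k ∈ Finset.range n, a k = ∑ l ∈ Finset.range ((n + 1) / 2), a (2 * l) +
      ∑ l ∈ Finset.range (n / 2), a (2 * l + 1) := by
  induction n with
  | zero => simp
  | succ n ih =>
    rw [Finset.sum_range_succ, ih]
    rcases Nat.even_or_odd' n with ⟨r, rfl | rfl⟩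
    · rw [show (2 * r + 1 + 1) / 2 = r + 1 by omega, show (2 * r + 1) / 2 = r by omega,
        show 2 * r / 2 = r by omega, Finset.sum_range_succ, add_right_comm]
    · rw [show (2 * r + 1 + 1 + 1) / 2 = r + 1 by omega, show (2 * r + 1 + 1) / 2 = r + 1 by omega,
        show (2 * r + 1) / 2 = r by omega, Finset.sum_range_succ _ r, Finset.sum_range_succ _ r,
        add_assoc]

variable [CompleteSpace E] [MeasurableSpace E] [BorelSpace E]
  {Ω : Type*} [MeasurableSpace Ω] {ℙ : Measure Ω}

/-- The strong law of large numbers restricted to the terms with index in an arbitrary set `T`: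
these terms, if infinitely many, form an i.i.d. sequence themselves. -/
lemma ae_tendsto_average_ite {W : ℕ → Ω → E} (hint : Integrable (W 0) ℙ)
    (hindep : Pairwise fun k l => ProbabilityTheory.IndepFun (W k) (W l) ℙ)
    (hident : ∀ k, ProbabilityTheory.IdentDistrib (W k) (W 0) ℙ ℙ)
    (T : ℕ → Prop) [DecidablePred T] :
    ∀ᵐ ω ∂ℙ, Tendsto (fun n : ℕ => (n : ℝ)⁻¹ • ∑ k ∈ Finset.range n,
      if T k then W k ω - ∫ ω, W 0 ω ∂ℙ else 0) atTop (𝓝 0) := by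
  set c := ∫ ω, W 0 ω ∂ℙ
  by_cases hT : {k | T k}.Infinite
  · have hnth := Nat.nth_injective hT
    have h0 := hident (Nat.nth T 0)
    have h := ProbabilityTheory.strong_law_ae (μ := ℙ) (fun l => W (Nat.nth T l))
      (h0.integrable_iff.2 hint) (fun k l hkl => hindep (hnth.ne hkl))
      (fun l => (hident _).trans h0.symm)
    filter_upwards [h] with ω hω
    rw [show ∫ ω, W (Nat.nth T 0) ω ∂ℙ = c from h0.integral_eq] at hω
    let B : ℕ → E := fun N => ∑ l ∈ Finset.range N, (W (Nat.nth T l) ω - c)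
    have hB : Tendsto (fun n : ℕ => (n : ℝ)⁻¹ • B n) atTop (𝓝 0) := by
      have := hω.sub_const c
      rw [sub_self] at this
      refine this.congr' ?_
      filter_upwards [eventually_ne_atTop 0] with n hn
      have hn' : (n : ℝ) ≠ 0 := Nat.cast_ne_zero.2 hn
      simp only [B, Finset.sum_sub_distrib, smul_sub, Finset.sum_const, Finset.card_range]
      rw [← Nat.cast_smul_eq_nsmul ℝ, smul_smul, inv_mul_cancel₀ hn', one_smul]
    have hsum : ∀ n, ∑ k ∈ Finset.range n, (if T k then W k ω - c else 0) =
        B (Nat.count T n) := fun n => by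
      induction n with
      | zero => simp [B]
      | succ n ih =>
        rw [Finset.sum_range_succ, ih, Nat.count_succ]
        by_cases hn : T n
        · simp only [hn, if_true, B]
          rw [Finset.sum_range_succ, Nat.nth_count hn]
        · simp [hn]
    simp only [hsum]
    refine tendsto_inv_smul_comp (by simp [B]) hB (fun n => Nat.count_le T) ?_
    refine tendsto_atTop_atTop_of_monotone (Nat.count_monotone T) fun N =>
      ⟨Nat.nth T N, (Nat.count_nth_of_infinite hT N).ge⟩
  · obtain ⟨K, hK⟩ := (Set.not_infinite.1 hT).bddAbove
    refine ae_of_all _ fun ω => ?_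
    have hconst : ∀ n, K + 1 ≤ n → ∑ k ∈ Finset.range n, (if T k then W k ω - c else 0) =
        ∑ k ∈ Finset.range (K + 1), (if T k then W k ω - c else 0) := fun n hn => by
      refine (Finset.sum_subset (Finset.range_mono hn) fun k _ hk => if_neg fun hTk => ?_).symm
      have := hK hTk
      rw [Finset.mem_range] at hk
      omega
    have h := (tendsto_inv_atTop_nhds_zero_nat (𝕜 := ℝ)).smul_const
      (∑ k ∈ Finset.range (K + 1), (if T k then W k ω - c else 0))
    rw [zero_smul] at h
    refine h.congr' ?_
    filter_upwards [eventually_ge_atTop (K + 1)] with n hn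
    rw [hconst n hn]

end Averages

section Signals

variable {E : Type*} [NormedAddCommGroup E] [NormedSpace ℝ E] [CompleteSpace E]
  [MeasurableSpace E] [BorelSpace E] [SecondCountableTopology E]
  {S : Type*} [MeasurableSpace S] {ι : Type*} [Fintype ι]
  {q : ι → Measure S} [∀ i, IsProbabilityMeasure (q i)] {f : S × S → E}

/-- Under the product measure, `u k i` is the signal that would be emitted at time `k` in the hidden
state `i`; all these are independent. -/
noncomputable def signalTable (q : ι → Measure S) : Measure (ℕ → ι → S) :=
  Measure.infinitePi fun _ => Measure.pi q

instance : IsProbabilityMeasure (signalTable q) := by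
  unfold signalTable
  infer_instance

lemma measurePreserving_signalTable {a b : ℕ} (hab : a ≠ b) (i j : ι) :
    MeasurePreserving (fun u : ℕ → ι → S => (u a i, u b j)) (signalTable q)
      ((q i).prod (q j)) := by
  have h1 : MeasurePreserving (fun u : ℕ → ι → S => (u a, u b)) (signalTable q)
      ((Measure.pi q).prod (Measure.pi q)) :=
    ⟨by fun_prop, Measure.infinitePi_map_eval_prod (P := fun _ : ℕ => Measure.pi q) hab⟩
  exact ((measurePreserving_eval q i).prod (measurePreserving_eval q j)).comp h1

/-- Transitions starting at times of the same parity use disjoint parts of the table. -/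
lemma ae_tendsto_average_parity (hf : Measurable f) {i j : ι}
    (hint : Integrable f ((q i).prod (q j))) (e : ℕ) (T : ℕ → Prop) [DecidablePred T] :
    ∀ᵐ u ∂(signalTable q), Tendsto (fun n : ℕ => (n : ℝ)⁻¹ • ∑ k ∈ Finset.range n,
      if T k then f (u (2 * k + e) i, u (2 * k + e + 1) j) - ∫ z, f z ∂((q i).prod (q j)) else 0)
      atTop (𝓝 0) := by
  have hmp : ∀ k, MeasurePreserving
      (fun u : ℕ → ι → S => (u (2 * k + e) i, u (2 * k + e + 1) j)) (signalTable q)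
      ((q i).prod (q j)) := fun k => measurePreserving_signalTable (by omega) i j
  have h := ae_tendsto_average_ite (ℙ := signalTable q)
    (W := fun k u => f (u (2 * k + e) i, u (2 * k + e + 1) j))
    ((hmp 0).integrable_comp_of_integrable hint) (fun k l hkl => ?_) (fun k => ?_) T
  · have h0 := (hmp 0).map_eq ▸ (integral_map (hmp 0).measurable.aemeasurable
      hf.aestronglyMeasurable)
    rw [h0]
    exact h
  · have hi : ProbabilityTheory.iIndepFun (fun (k : ℕ) (u : ℕ → ι → S) => u k) (signalTable q) :=
      ProbabilityTheory.iIndepFun_infinitePi (P := fun _ : ℕ => Measure.pi q)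
        (X := fun _ v => v) fun _ => measurable_id
    have h2 := hi.indepFun_prodMk_prodMk (fun k => measurable_pi_apply k)
      (2 * k + e) (2 * k + e + 1) (2 * l + e) (2 * l + e + 1)
      (by omega) (by omega) (by omega) (by omega)
    have hg : Measurable fun z : (ι → S) × (ι → S) => f (z.1 i, z.2 j) := by fun_prop
    exact h2.comp hg hg
  · refine ⟨(hf.comp (hmp k).measurable).aemeasurable, (hf.comp (hmp 0).measurable).aemeasurable, ?_⟩
    have h3 : ∀ k, (signalTable q).map (fun u => f (u (2 * k + e) i, u (2 * k + e + 1) j)) =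
        ((q i).prod (q j)).map f := fun k => by
      rw [← (hmp k).map_eq, Measure.map_map hf (hmp k).measurable]
      rfl
    rw [h3 k, h3 0]

/-- For a fixed path `x` of hidden states, the conditionally centred averages vanish. -/
lemma ae_tendsto_average_of_path (hf : Measurable f)
    (hint : ∀ i j, Integrable f ((q i).prod (q j))) (x : ℕ → ι) :
    ∀ᵐ u ∂(signalTable q), Tendsto (fun n : ℕ => (n : ℝ)⁻¹ • ∑ k ∈ Finset.range n,
      (f (u k (x k), u (k + 1) (x (k + 1))) - ∫ z, f z ∂((q (x k)).prod (q (x (k + 1))))))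
      atTop (𝓝 0) := by
  classical
  have h : ∀ᵐ u ∂(signalTable q), ∀ i j, Tendsto (fun n : ℕ => (n : ℝ)⁻¹ • ∑ k ∈ Finset.range n,
      if x k = i ∧ x (k + 1) = j then f (u k i, u (k + 1) j) - ∫ z, f z ∂((q i).prod (q j)) else 0)
      atTop (𝓝 0) := by
    rw [ae_all_iff]
    intro i
    rw [ae_all_iff]
    intro j
    filter_upwards [ae_tendsto_average_parity hf (hint i j) 0
      (fun k => x (2 * k) = i ∧ x (2 * k + 1) = j),
      ae_tendsto_average_parity hf (hint i j) 1
      (fun k => x (2 * k + 1) = i ∧ x (2 * k + 1 + 1) = j)] with u h0 h1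
    have h2 := (tendsto_inv_smul_comp (by simp) h0 (c := fun n => (n + 1) / 2)
      (fun n => by omega) (tendsto_atTop_mono (fun n => by omega : ∀ n, n / 2 ≤ (n + 1) / 2)
        (Nat.tendsto_div_const_atTop two_ne_zero))).add
      (tendsto_inv_smul_comp (by simp) h1 (c := fun n => n / 2)
      (fun n => by omega) (Nat.tendsto_div_const_atTop two_ne_zero))
    rw [add_zero] at h2
    refine h2.congr fun n => ?_
    rw [← smul_add]
    exact congrArg _ (sum_range_eq_even_add_odd (fun k => if x k = i ∧ x (k + 1) = j then
      f (u k i, u (k + 1) j) - ∫ z, f z ∂((q i).prod (q j)) else 0) n).symm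
  filter_upwards [h] with u hu
  have h2 := tendsto_finsetSum Finset.univ fun i _ => tendsto_finsetSum Finset.univ fun j _ => hu i j
  simp only [Finset.sum_const_zero] at h2
  refine h2.congr fun n => ?_
  simp only [← Finset.smul_sum]
  congr 1
  simp only [Finset.sum_comm (t := Finset.range n)]
  simp [ite_and]

end Signals

/-! ### Law of large numbers for hidden Markov models -/

section HiddenMarkov

variable {m d M : ℕ} {S : Type*} [MeasurableSpace S] {F : Family m d M S}
  {θ : EuclideanSpace ℝ (Fin M)} {ν : Fin m → ℝ} {Ω : Type*} [MeasurableSpace Ω] {ℙ : Measure Ω}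
  {X : ℕ → Ω → Fin m} {Y : ℕ → Ω → S}

lemma Family.isProbabilityMeasure_signal (F : Family m d M S) {b : EuclideanSpace ℝ (Fin d)}
    (hb : b ∈ closure F.O) : IsProbabilityMeasure (F.signal b) :=
  (F.signalPM ⟨b, hb⟩).2

lemma Family.IsHMM.isMarkovChain (h : F.IsHMM θ ν ℙ X Y) : IsMarkovChain (F.p θ) ν ℙ X :=
  ⟨h.measurable_state, h.law_state⟩

/-- The signal process read off from a table of independent signals along the hidden path. -/
def readTable (X : ℕ → Ω → Fin m) (z : Ω × (ℕ → Fin m → S)) : ℕ → S := fun k => z.2 k (X k z.1)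

lemma measurable_readTable (hX : ∀ n, Measurable (X n)) :
    Measurable (readTable X : Ω × (ℕ → Fin m → S) → ℕ → S) := by
  refine measurable_pi_lambda _ fun k => ?_
  have h1 : Measurable fun z : Fin m × (Fin m → S) => z.2 z.1 :=
    measurable_from_prod_countable_right fun i => measurable_pi_apply i
  exact h1.comp (((hX k).comp measurable_fst).prodMk
    ((measurable_pi_apply k).comp measurable_snd))

/-- The law of the signals as a mixture, over hidden paths, of product measures. -/
lemma Family.IsHMM.measure_signal_box [IsProbabilityMeasure ℙ] (h : F.IsHMM θ ν ℙ X Y) (n : ℕ)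
    {A : ℕ → Set S} (hA : ∀ k, MeasurableSet (A k)) :
    ℙ {ω | ∀ k ≤ n, Y k ω ∈ A k} = ∑ x : Fin (n + 1) → Fin m,
      (∏ k : Fin (n + 1), F.signal (F.β θ (x k)) (A k)) * ℙ (history X n ⁻¹' {x}) := by
  have hE : MeasurableSet {ω | ∀ k ≤ n, Y k ω ∈ A k} := by
    have : {ω | ∀ k ≤ n, Y k ω ∈ A k} = ⋂ k, ⋂ (_ : k ≤ n), Y k ⁻¹' A k := by
      ext ω; simp
    rw [this]
    exact MeasurableSet.iInter fun k => MeasurableSet.iInter fun _ => h.measurable_signal k (hA k)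
  have h1 := sum_measure_preimage_singleton (μ := ℙ.restrict {ω | ∀ k ≤ n, Y k ω ∈ A k})
    Finset.univ (f := history X n)
    fun x _ => measurable_history h.measurable_state n (measurableSet_singleton x)
  rw [Finset.coe_univ, Set.preimage_univ, Measure.restrict_apply_univ] at h1
  rw [← h1]
  refine Finset.sum_congr rfl fun x _ => ?_
  rw [Measure.restrict_apply (measurable_history h.measurable_state n (measurableSet_singleton x))]
  -- the values of `x'` after time `n` are irrelevant
  let x' : ℕ → Fin m := fun k => if hk : k < n + 1 then x ⟨k, hk⟩ else x 0
  have hx' : ∀ k : Fin (n + 1), x' k = x k := fun k => dif_pos k.2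
  have hhist : ∀ ω, history X n ω = x ↔ ∀ k ≤ n, X k ω = x' k := fun ω => by
    simp only [funext_iff, history, ← hx']
    exact ⟨fun H k hk => H ⟨k, Nat.lt_succ_of_le hk⟩, fun H k => H k (Nat.lt_succ_iff.1 k.2)⟩
  have h2 := h.law_signal n x' A hA
  have h3 : history X n ⁻¹' {x} = {ω | ∀ k ≤ n, X k ω = x' k} := by
    ext ω; exact hhist ω
  rw [h3]
  have h4 : {ω | ∀ k ≤ n, X k ω = x' k} ∩ {ω | ∀ k ≤ n, Y k ω ∈ A k} =
      {ω | (∀ k ≤ n, X k ω = x' k) ∧ ∀ k ≤ n, Y k ω ∈ A k} := rfl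
  rw [h4, h2, mul_comm, Finset.prod_range]
  simp only [hx']

lemma measure_readTable_box [IsProbabilityMeasure ℙ] (hX : ∀ n, Measurable (X n))
    (q : Fin m → Measure S) [∀ i, IsProbabilityMeasure (q i)] (n : ℕ)
    {A : ℕ → Set S} (hA : ∀ k, MeasurableSet (A k)) :
    (ℙ.prod (signalTable q)) {z | ∀ k ≤ n, readTable X z k ∈ A k} =
      ∑ x : Fin (n + 1) → Fin m,
        (∏ k : Fin (n + 1), q (x k) (A k)) * ℙ (history X n ⁻¹' {x}) := by
  have hE : MeasurableSet {z : Ω × (ℕ → Fin m → S) | ∀ k ≤ n, readTable X z k ∈ A k} := by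
    have : {z : Ω × (ℕ → Fin m → S) | ∀ k ≤ n, readTable X z k ∈ A k} =
        ⋂ k, ⋂ (_ : k ≤ n), (fun z => readTable X z k) ⁻¹' A k := by
      ext ω; simp
    rw [this]
    exact MeasurableSet.iInter fun k => MeasurableSet.iInter fun _ =>
      ((measurable_pi_apply k).comp (measurable_readTable hX)) (hA k)
  rw [Measure.prod_apply hE]
  have h1 : ∀ ω, signalTable q
      (Prod.mk ω ⁻¹' {z : Ω × (ℕ → Fin m → S) | ∀ k ≤ n, readTable X z k ∈ A k}) =
      ∏ k : Fin (n + 1), q (history X n ω k) (A k) := fun ω => by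
    have h2 : (Prod.mk ω ⁻¹' {z : Ω × (ℕ → Fin m → S) | ∀ k ≤ n, readTable X z k ∈ A k}) =
        Set.pi (Finset.range (n + 1)) fun k => (fun v : Fin m → S => v (X k ω)) ⁻¹' A k := by
      ext u
      simp [readTable]
    rw [h2, signalTable, Measure.infinitePi_pi _ fun k _ => measurable_pi_apply _ (hA k),
      Finset.prod_range]
    refine Finset.prod_congr rfl fun k _ => ?_
    exact (measurePreserving_eval q (X k ω)).measure_preimage (hA k).nullMeasurableSet
  simp only [h1]
  rw [← lintegral_map (f := fun x : Fin (n + 1) → Fin m => ∏ k : Fin (n + 1), q (x k) (A k))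
    (measurable_of_countable _) (measurable_history hX n), lintegral_fintype]
  refine Finset.sum_congr rfl fun x _ => ?_
  rw [Measure.map_apply (measurable_history hX n) (measurableSet_singleton x)]

/-- The signals of a hidden Markov model have the law of the signals read off from an independent
table along the hidden path. -/
lemma Family.IsHMM.map_eq [IsProbabilityMeasure ℙ] (h : F.IsHMM θ ν ℙ X Y)
    [∀ i, IsProbabilityMeasure (F.signal (F.β θ i))] :
    ℙ.map (fun ω k => Y k ω) =
      (ℙ.prod (signalTable fun i => F.signal (F.β θ i))).map (readTable X) := by
  have hY : Measurable fun ω k => Y k ω := measurable_pi_lambda _ h.measurable_signal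
  have hR := measurable_readTable (S := S) h.measurable_state
  have : IsProbabilityMeasure (ℙ.map fun ω k => Y k ω) :=
    Measure.isProbabilityMeasure_map hY.aemeasurable
  have : IsProbabilityMeasure
      ((ℙ.prod (signalTable fun i => F.signal (F.β θ i))).map (readTable X)) :=
    Measure.isProbabilityMeasure_map hR.aemeasurable
  refine ext_of_generate_finite _ generateFrom_squareCylinders.symm
    (isPiSystem_squareCylinders (fun _ => MeasurableSpace.isPiSystem_measurableSet) fun _ => MeasurableSet.univ)
    ?_ (by simp)
  rintro _ ⟨s, t, ht, rfl⟩
  simp only [Set.mem_univ_pi, Set.mem_ofPred_eq] at ht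
  classical
  let n := s.sup id
  let A : ℕ → Set S := fun k => if k ∈ s then t k else Set.univ
  have hA : ∀ k, MeasurableSet (A k) := fun k => by
    by_cases hk : k ∈ s
    · simpa [A, hk] using ht k
    · simp [A, hk]
  have hbox : ∀ y : ℕ → S, y ∈ (s : Set ℕ).pi t ↔ ∀ k ≤ n, y k ∈ A k := fun y => by
    constructor
    · intro H k _
      by_cases hk : k ∈ s
      · simpa [A, hk] using H k hk
      · simp [A, hk]
    · intro H k hk
      simpa [A, Finset.mem_coe.1 hk] using H k (Finset.le_sup (f := id) hk)
  have hm : MeasurableSet ((s : Set ℕ).pi t) :=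
    MeasurableSet.pi s.countable_toSet fun k _ => ht k
  rw [Measure.map_apply hY hm, Measure.map_apply hR hm]
  have e1 : (fun ω k => Y k ω) ⁻¹' (s : Set ℕ).pi t = {ω | ∀ k ≤ n, Y k ω ∈ A k} := by
    ext ω; exact hbox _
  have e2 : readTable X ⁻¹' (s : Set ℕ).pi t =
      {z : Ω × (ℕ → Fin m → S) | ∀ k ≤ n, readTable X z k ∈ A k} := by
    ext ω; exact hbox _
  rw [e1, e2, h.measure_signal_box n hA,
    measure_readTable_box h.measurable_state (fun i => F.signal (F.β θ i)) n hA]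

/-- Strong law of large numbers for Banach space valued functions of consecutive signals, for
every initial law. -/
lemma Family.IsHMM.ae_tendsto_average [IsProbabilityMeasure ℙ] (h : F.IsHMM θ ν ℙ X Y)
    (hP : F.p θ ∈ Matrix.rowStochastic ℝ (Fin m)) (hν : ν ∈ stdSimplex ℝ (Fin m))
    (hβ : ∀ i, F.β θ i ∈ closure F.O) {N : ℕ} (hpos : ∀ i j, 0 < (F.p θ ^ N) i j)
    {μ : Fin m → ℝ} (hμ : μ ∈ stdSimplex ℝ (Fin m)) (hinv : Matrix.vecMul μ (F.p θ) = μ)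
    {E : Type*} [NormedAddCommGroup E] [NormedSpace ℝ E] [CompleteSpace E]
    [MeasurableSpace E] [BorelSpace E] [SecondCountableTopology E] {f : S × S → E}
    (hf : Measurable f)
    (hint : ∀ i j, Integrable f ((F.signal (F.β θ i)).prod (F.signal (F.β θ j)))) :
    ∀ᵐ ω ∂ℙ, Tendsto
      (fun n : ℕ => (n : ℝ)⁻¹ • ∑ k ∈ Finset.range n, f (Y k ω, Y (k + 1) ω)) atTop
      (𝓝 (∑ i, ∑ j, (μ i * F.p θ i j) •
        ∫ z, f z ∂((F.signal (F.β θ i)).prod (F.signal (F.β θ j))))) := by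
  have hprob : ∀ i, IsProbabilityMeasure (F.signal (F.β θ i)) := fun i =>
    F.isProbabilityMeasure_signal (hβ i)
  set c := ∑ i, ∑ j, (μ i * F.p θ i j) •
    ∫ z, f z ∂((F.signal (F.β θ i)).prod (F.signal (F.β θ j))) with hc
  have hmeas : MeasurableSet {y : ℕ → S | Tendsto
      (fun n : ℕ => (n : ℝ)⁻¹ • ∑ k ∈ Finset.range n, f (y k, y (k + 1))) atTop (𝓝 c)} := by
    refine measurableSet_tendsto_fun (fun n => ?_) measurable_const
    refine (Finset.measurable_sum _ fun k _ => hf.comp ?_).const_smul _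
    exact (measurable_pi_apply k).prodMk (measurable_pi_apply (k + 1))
  have hY : Measurable fun ω k => Y k ω := measurable_pi_lambda _ h.measurable_signal
  have hR := measurable_readTable (S := S) h.measurable_state
  refine (ae_map_iff hY.aemeasurable hmeas).1 ?_
  rw [h.map_eq, ae_map_iff hR.aemeasurable hmeas]
  refine (Measure.ae_prod_iff_ae_ae (hR hmeas)).2 ?_
  filter_upwards [h.isMarkovChain.ae_tendsto_average hP hν.1 hpos hμ hinv fun i j =>
    ∫ z, f z ∂((F.signal (F.β θ i)).prod (F.signal (F.β θ j)))] with ω hω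
  filter_upwards [ae_tendsto_average_of_path (q := fun i => F.signal (F.β θ i)) hf hint
    fun k => X k ω] with u hu
  have h1 := hu.add hω
  rw [zero_add, ← hc] at h1
  refine h1.congr fun n => ?_
  rw [← smul_add, ← Finset.sum_add_distrib]
  simp only [sub_add_cancel]
  rfl

end HiddenMarkov

/-! ### Oscillation of the signal densities -/

section Oscillation

lemma ereal_abs_eq_max (x : EReal) : x.abs = max x.toENNReal (-x).toENNReal := by
  induction x with
  | bot => simp
  | top => simp
  | coe x =>
    rw [EReal.abs_def, ← EReal.coe_neg, EReal.toENNReal_of_ne_top (EReal.coe_ne_top _),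
      EReal.toENNReal_of_ne_top (EReal.coe_ne_top _), EReal.toReal_coe, EReal.toReal_coe,
      ← (ENNReal.ofReal_mono).map_max]
    rfl

lemma continuous_ereal_abs : Continuous EReal.abs := by
  rw [funext ereal_abs_eq_max]
  exact EReal.continuous_toENNReal.max (EReal.continuous_toENNReal.comp continuous_neg)

lemma abs_log_div_coe {a b : ℝ≥0} (ha : a ≠ 0) (hb : b ≠ 0) :
    (ENNReal.log ((a : ℝ≥0∞) / b)).abs = ENNReal.ofReal |Real.log (a / b)| := by
  rw [← ENNReal.coe_div hb, ENNReal.log_of_nnreal (div_ne_zero ha hb), EReal.abs_def, NNReal.coe_div]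

namespace Family

variable {m d M : ℕ} {S : Type*} [MeasurableSpace S] (F : Family m d M S)

/-- The supremum over `b'` of `|log (q_b(y) / q_b'(y))|`. -/
noncomputable def logOsc (b : EuclideanSpace ℝ (Fin d)) (y : S) : ℝ≥0∞ :=
  ⨆ b' ∈ closure F.O, (ENNReal.log ((F.q b y : ℝ≥0∞) / (F.q b' y : ℝ≥0∞))).abs

variable {F}

/-- Continuity of the densities reduces the supremum to a countable one. -/
lemma H4.aemeasurable_logOsc (h4 : F.H4) {b : EuclideanSpace ℝ (Fin d)} (hb : b ∈ closure F.O) :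
    AEMeasurable (F.logOsc b) F.σ := by
  obtain ⟨D, hDc, hD⟩ := TopologicalSpace.exists_countable_dense (closure F.O)
  refine ⟨fun y => ⨆ b' ∈ D, (ENNReal.log ((F.q b y : ℝ≥0∞) / (F.q b' y : ℝ≥0∞))).abs, ?_, ?_⟩
  · refine Measurable.biSup D hDc fun b' _ => continuous_ereal_abs.measurable.comp ?_
    exact ((F.measurable_q b hb).coe_nnreal_ennreal.div
      (F.measurable_q b' b'.2).coe_nnreal_ennreal).ennreal_log
  · filter_upwards [h4.continuous_density] with y hy
    rw [continuousOn_iff_continuous_domRestrict] at hy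
    have hy' : Continuous fun b' : closure F.O => F.q b' y := hy
    -- if `q_b(y) = 0`, then both suprema are `∞`, as `log (0 / _) = log 0 = ⊥`
    rcases eq_or_ne (F.q b y) 0 with h0 | h0
    · simp only [logOsc, h0, ENNReal.coe_zero, ENNReal.zero_div, ENNReal.log_zero, EReal.abs_bot]
      obtain ⟨b', hb'⟩ : D.Nonempty := by
        have : Nonempty (closure F.O) := ⟨⟨b, hb⟩⟩
        exact hD.nonempty
      exact (top_le_iff.1 (le_iSup₂_of_le b hb le_rfl)).trans
        (top_le_iff.1 (le_iSup₂_of_le b' hb' le_rfl)).symm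
    · have hc : Continuous fun b' : closure F.O =>
          (ENNReal.log ((F.q b y : ℝ≥0∞) / (F.q b' y : ℝ≥0∞))).abs := by
        refine continuous_ereal_abs.comp (ENNReal.continuous_log.comp ?_)
        simp only [div_eq_mul_inv]
        refine (ENNReal.continuous_const_mul ENNReal.coe_ne_top).comp ?_
        exact continuous_inv.comp (ENNReal.continuous_coe.comp hy')
      refine le_antisymm (iSup₂_le fun b' hb' => ?_) (iSup₂_le fun b' hb' => ?_)
      · have hcl := isClosed_le hc (continuous_const (y := ⨆ b' ∈ D,
          (ENNReal.log ((F.q b y : ℝ≥0∞) / (F.q b' y : ℝ≥0∞))).abs))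
        exact hcl.closure_subset_iff.2 (fun b'' hb'' => le_iSup₂ (f := fun (b' : closure F.O)
          (_ : b' ∈ D) => (ENNReal.log ((F.q b y : ℝ≥0∞) / (F.q b' y : ℝ≥0∞))).abs) b'' hb'')
          (hD (⟨b', hb'⟩ : closure F.O))
      · exact le_iSup₂_of_le (b' : EuclideanSpace ℝ (Fin d)) b'.2 le_rfl

/-- Signals for which all densities are positive and depend continuously on the parameter. -/
def IsRegular (F : Family m d M S) (y : S) : Prop :=
  (∀ b ∈ closure F.O, F.q b y ≠ 0) ∧ ContinuousOn (fun b => F.q b y) (closure F.O)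

/-- A zero of a density would make `logOsc` infinite, which (H4) excludes almost everywhere. -/
lemma H4.ae_isRegular (h4 : F.H4) {b : EuclideanSpace ℝ (Fin d)} (hb : b ∈ closure F.O) :
    ∀ᵐ y ∂(F.signal b), F.IsRegular y := by
  have hac : F.signal b ≪ F.σ := withDensity_absolutelyContinuous _ _
  filter_upwards [hac.ae_le h4.continuous_density, ae_lt_top'
    ((h4.aemeasurable_logOsc hb).mono_ac hac) (h4.integrable_log b hb).ne] with y hy hlt
  have hlt' : ∀ b' ∈ closure F.O,
      (ENNReal.log ((F.q b y : ℝ≥0∞) / (F.q b' y : ℝ≥0∞))).abs < ∞ := fun b' hb' =>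
    (le_iSup₂_of_le b' hb' le_rfl).trans_lt hlt
  have h0 : F.q b y ≠ 0 := fun h0 => by
    have := hlt' b hb
    simp [h0] at this
  refine ⟨fun b' hb' h => ?_, hy⟩
  have := hlt' b' hb'
  rw [h, ENNReal.coe_zero, ENNReal.div_zero (by simpa using h0)] at this
  simp at this

lemma H4.exists_measurableSet_isRegular (h4 : F.H4) {b₀ : EuclideanSpace ℝ (Fin d)}
    (hb₀ : b₀ ∈ closure F.O) : ∃ G : Set S, MeasurableSet G ∧ (∀ y ∈ G, F.IsRegular y) ∧
      ∀ b ∈ closure F.O, ∀ᵐ y ∂(F.signal b), y ∈ G := by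
  have h := h4.ae_isRegular hb₀
  rw [ae_iff] at h
  obtain ⟨N, hN, hNm, hN0⟩ := exists_measurable_superset_of_null h
  refine ⟨Nᶜ, hNm.compl, fun y hy => by_contra fun h => hy (hN h), fun b hb => ?_⟩
  rw [ae_iff]
  simpa using h4.equivalent b hb b₀ hb₀ hN0

/-- All densities at a regular signal are within the factor `exp (logOsc b y)` of `q_b(y)`. -/
lemma IsRegular.q_mem_Icc {y : S} (hy : F.IsRegular y) {b b' : EuclideanSpace ℝ (Fin d)}
    (hb : b ∈ closure F.O) (hb' : b' ∈ closure F.O) (hfin : F.logOsc b y ≠ ∞) :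
    (F.q b' y : ℝ) ∈ Set.Icc (F.q b y * Real.exp (-(F.logOsc b y).toReal))
      (F.q b y * Real.exp (F.logOsc b y).toReal) := by
  have h1 : (ENNReal.log ((F.q b y : ℝ≥0∞) / (F.q b' y : ℝ≥0∞))).abs ≤ F.logOsc b y :=
    le_iSup₂_of_le b' hb' le_rfl
  rw [abs_log_div_coe (hy.1 b hb) (hy.1 b' hb'), ENNReal.ofReal_le_iff_le_toReal hfin, abs_le] at h1
  have p : (0 : ℝ) < F.q b y := by exact_mod_cast pos_iff_ne_zero.2 (hy.1 b hb)
  have p' : (0 : ℝ) < F.q b' y := by exact_mod_cast pos_iff_ne_zero.2 (hy.1 b' hb')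
  rw [Real.log_div p.ne' p'.ne'] at h1
  rw [← Real.exp_log p, ← Real.exp_log p', ← Real.exp_add, ← Real.exp_add]
  constructor <;> rw [Real.exp_le_exp] <;> linarith

end Family

end Oscillation

/-! ### The log-likelihood ratio as a random continuous function -/

/-- A map into `C(K, ℝ)` is measurable if its evaluations are: evaluation along a dense sequence is
a continuous injection between Polish spaces, hence a measurable embedding. -/
lemma measurable_of_eval {α K : Type*} [MeasurableSpace α] [MetricSpace K] [CompactSpace K]
    [MeasurableSpace C(K, ℝ)] [BorelSpace C(K, ℝ)] {f : α → C(K, ℝ)}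
    (hf : ∀ t, Measurable fun a => f a t) : Measurable f := by
  obtain ⟨D, hDc, hD⟩ := TopologicalSpace.exists_countable_dense K
  have := hDc.to_subtype
  have hc : Continuous fun (g : C(K, ℝ)) (t : D) => g t :=
    continuous_pi fun t => continuous_eval_const (t : K)
  have hinj : Function.Injective fun (g : C(K, ℝ)) (t : D) => g t := fun g g' h => by
    refine ContinuousMap.coe_injective ?_
    exact Continuous.ext_on hD g.continuous g'.continuous fun t ht => congrFun h ⟨t, ht⟩
  refine (hc.measurableEmbedding hinj).measurable_comp_iff.1 ?_
  exact measurable_pi_lambda _ fun t => hf t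

namespace Family

variable {m d M : ℕ} {S : Type*} [MeasurableSpace S] {F : Family m d M S}

instance : CompactSpace F.Θ := isCompact_iff_compactSpace.1
  (Metric.isCompact_of_isClosed_isBounded isClosed_closure F.isBounded_Θ₀.closure)

lemma H1.exists_pow_pos (h1 : F.H1) : ∃ N : ℕ, ∀ t ∈ F.Θ, ∀ i j, 0 < (F.p t ^ N) i j := by
  obtain ⟨N, -, κ, hκ, ν₀, -, hν₀, h⟩ := h1
  exact ⟨N, fun t ht i j => (mul_pos hκ (hν₀ j)).trans_le (h t ht i j)⟩

section Weights

variable {t : EuclideanSpace ℝ (Fin M)}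

lemma measurable_pairDensity (hβ : ∀ i, F.β t i ∈ closure F.O) :
    Measurable fun z : S × S => F.pairDensity t z.1 z.2 := by
  refine Finset.measurable_sum _ fun i _ => Finset.measurable_sum _ fun j _ => ?_
  exact (((F.measurable_q _ (hβ i)).comp measurable_fst).coe_nnreal_real.const_mul _).mul
    ((F.measurable_q _ (hβ j)).comp measurable_snd).coe_nnreal_real

variable [NeZero m]

lemma invariantLaw_spec (ht : t ∈ F.Θ) : F.invariantLaw t ∈ stdSimplex ℝ (Fin m) ∧
    Matrix.vecMul (F.invariantLaw t) (F.p t) = F.invariantLaw t := by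
  have h := exists_invariant (F.stochastic t ht)
  rw [invariantLaw, dif_pos h]
  exact h.choose_spec

lemma H1.invariantLaw_pos (h1 : F.H1) (ht : t ∈ F.Θ) (i : Fin m) : 0 < F.invariantLaw t i := by
  obtain ⟨N, hN⟩ := h1.exists_pow_pos
  exact invariant_pos (hN t ht) (invariantLaw_spec ht).1 (invariantLaw_spec ht).2 i

lemma weight_nonneg (ht : t ∈ F.Θ) (i j : Fin m) : 0 ≤ F.invariantLaw t i * F.p t i j :=
  mul_nonneg ((invariantLaw_spec ht).1.1 i) ((F.stochastic t ht).1 i j)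

lemma sum_weight (ht : t ∈ F.Θ) : ∑ i, ∑ j, F.invariantLaw t i * F.p t i j = 1 := by
  simp only [← Finset.mul_sum, Matrix.sum_row_of_mem_rowStochastic (F.stochastic t ht), mul_one]
  exact (invariantLaw_spec ht).1.2

/-- The pair density is an average of products of signal densities. -/
lemma pairDensity_mem_Icc (ht : t ∈ F.Θ) {y y' : S} {a a' c c' : ℝ} (ha : 0 ≤ a) (hc : 0 ≤ c)
    (hy : ∀ i, (F.q (F.β t i) y : ℝ) ∈ Set.Icc a a')
    (hy' : ∀ i, (F.q (F.β t i) y' : ℝ) ∈ Set.Icc c c') :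
    F.pairDensity t y y' ∈ Set.Icc (a * c) (a' * c') := by
  have h : ∀ e : ℝ, e = ∑ i, ∑ j, F.invariantLaw t i * F.p t i j * e := fun e => by
    simp only [← Finset.sum_mul, sum_weight ht, one_mul]
  constructor
  · rw [h (a * c)]
    refine Finset.sum_le_sum fun i _ => Finset.sum_le_sum fun j _ => ?_
    rw [mul_assoc (_ * _)]
    exact mul_le_mul_of_nonneg_left (mul_le_mul (hy i).1 (hy' j).1 hc (ha.trans (hy i).1))
      (weight_nonneg ht i j)
  · rw [h (a' * c')]
    refine Finset.sum_le_sum fun i _ => Finset.sum_le_sum fun j _ => ?_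
    rw [mul_assoc (_ * _)]
    exact mul_le_mul_of_nonneg_left (mul_le_mul (hy i).2 (hy' j).2 (NNReal.coe_nonneg _)
      ((NNReal.coe_nonneg _).trans (hy i).2)) (weight_nonneg ht i j)

lemma pairDensity_nonneg (ht : t ∈ F.Θ) (y y' : S) : 0 ≤ F.pairDensity t y y' :=
  Finset.sum_nonneg fun i _ => Finset.sum_nonneg fun j _ =>
    mul_nonneg (mul_nonneg (weight_nonneg ht i j) (NNReal.coe_nonneg _)) (NNReal.coe_nonneg _)

lemma pairDensity_pos (ht : t ∈ F.Θ) (hβ : ∀ i, F.β t i ∈ closure F.O) {y y' : S}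
    (hy : F.IsRegular y) (hy' : F.IsRegular y') : 0 < F.pairDensity t y y' := by
  have h : ∀ y, F.IsRegular y → ∃ a : ℝ, 0 < a ∧ ∀ i, a ≤ F.q (F.β t i) y := fun y hy => by
    obtain ⟨k, hk⟩ := Finite.exists_min fun i => (F.q (F.β t i) y : ℝ)
    exact ⟨_, by exact_mod_cast pos_iff_ne_zero.2 (hy.1 _ (hβ k)), hk⟩
  have h' : ∀ y, ∃ a : ℝ, ∀ i, F.q (F.β t i) y ≤ a := fun y => by
    obtain ⟨k, hk⟩ := Finite.exists_max fun i => (F.q (F.β t i) y : ℝ)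
    exact ⟨_, hk⟩
  obtain ⟨a, ha, hay⟩ := h y hy
  obtain ⟨c, hc, hcy⟩ := h y' hy'
  obtain ⟨a', ha'⟩ := h' y
  obtain ⟨c', hc'⟩ := h' y'
  exact (mul_pos ha hc).trans_le (pairDensity_mem_Icc ht ha.le hc.le
    (fun i => ⟨hay i, ha' i⟩) (fun i => ⟨hcy i, hc' i⟩)).1

lemma continuousOn_pairDensity (h1 : F.H1) (hβ : ∀ t ∈ F.Θ, ∀ i, F.β t i ∈ closure F.O)
    (hc : ContinuousOn (fun t => (F.p t, F.β t)) F.Θ) {y y' : S}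
    (hy : F.IsRegular y) (hy' : F.IsRegular y') :
    ContinuousOn (fun t => F.pairDensity t y y') F.Θ := by
  obtain ⟨N, hN⟩ := h1.exists_pow_pos
  have hp : ContinuousOn F.p F.Θ := continuous_fst.comp_continuousOn hc
  have hb : ContinuousOn F.β F.Θ := continuous_snd.comp_continuousOn hc
  have hμ : ContinuousOn F.invariantLaw F.Θ := continuousOn_invariant F.stochastic
    (fun t ht => ⟨N, hN t ht⟩) hp (fun t ht => (invariantLaw_spec ht).1)
    (fun t ht => (invariantLaw_spec ht).2)
  have hq : ∀ y, F.IsRegular y → ∀ i, ContinuousOn (fun t => (F.q (F.β t i) y : ℝ)) F.Θ :=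
    fun y hy i => NNReal.continuous_coe.comp_continuousOn
      (hy.2.comp ((continuous_apply i).comp_continuousOn hb) fun t ht => hβ t ht i)
  refine continuousOn_finsetSum _ fun i _ => continuousOn_finsetSum _ fun j _ => ?_
  refine ((ContinuousOn.mul ((continuous_apply i).comp_continuousOn hμ) ?_).mul (hq y hy i)).mul
    (hq y' hy' j)
  exact (continuous_apply_apply i j).comp_continuousOn hp

lemma abs_log_ratio_le (hβ : ∀ t ∈ F.Θ, ∀ i, F.β t i ∈ closure F.O)
    {t' : EuclideanSpace ℝ (Fin M)} (ht : t ∈ F.Θ) (ht' : t' ∈ F.Θ) {y y' : S}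
    (hy : F.IsRegular y) (hy' : F.IsRegular y') {b b' : EuclideanSpace ℝ (Fin d)}
    (hb : b ∈ closure F.O) (hb' : b' ∈ closure F.O) (hfin : F.logOsc b y ≠ ∞)
    (hfin' : F.logOsc b' y' ≠ ∞) :
    |Real.log (F.pairDensity t y y' / F.pairDensity t' y y')| ≤
      2 * ((F.logOsc b y).toReal + (F.logOsc b' y').toReal) := by
  have p : (0 : ℝ) < F.q b y := by exact_mod_cast pos_iff_ne_zero.2 (hy.1 b hb)
  have p' : (0 : ℝ) < F.q b' y' := by exact_mod_cast pos_iff_ne_zero.2 (hy'.1 b' hb')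
  have key : ∀ t ∈ F.Θ, |Real.log (F.pairDensity t y y') - Real.log (F.q b y * F.q b' y')| ≤
      (F.logOsc b y).toReal + (F.logOsc b' y').toReal := fun t ht => by
    obtain ⟨hl, hu⟩ := pairDensity_mem_Icc ht (by positivity) (by positivity)
      (fun i => hy.q_mem_Icc hb (hβ t ht i) hfin) (fun i => hy'.q_mem_Icc hb' (hβ t ht i) hfin')
    have hQ := pairDensity_pos ht (hβ t ht) hy hy'
    have e1 : ∀ r r' : ℝ, F.q b y * Real.exp r * (F.q b' y' * Real.exp r') =
        Real.exp (Real.log (F.q b y * F.q b' y') + (r + r')) := fun r r' => by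
      rw [Real.exp_add, Real.exp_log (mul_pos p p'), Real.exp_add]
      ring
    rw [e1, ← Real.exp_log hQ, Real.exp_le_exp] at hl hu
    rw [abs_le]
    constructor <;> linarith
  rw [Real.log_div (pairDensity_pos ht (hβ t ht) hy hy').ne'
    (pairDensity_pos ht' (hβ t' ht') hy hy').ne']
  have h1 := abs_le.1 (key t ht)
  have h2 := abs_le.1 (key t' ht')
  rw [abs_le]
  constructor <;> linarith

end Weights

open Classical in
/-- The log-likelihood ratio `t ↦ log (Q_t(y, y') / Q_θ(y, y'))` as a continuous function on `Θ`,
for `(y, y')` in `G × G`; the value is `0` off `G × G`, where continuity may fail. -/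
noncomputable def logRatio (F : Family m d M S) (G : Set S) (θ : EuclideanSpace ℝ (Fin M))
    (z : S × S) : C(F.Θ, ℝ) :=
  if z ∈ G ×ˢ G then ContinuousMap.mkD
    (fun t : F.Θ => Real.log (F.pairDensity t z.1 z.2 / F.pairDensity θ z.1 z.2)) 0
  else 0

section LogRatio

variable [NeZero m] {G : Set S} {θ : EuclideanSpace ℝ (Fin M)}

lemma logRatio_apply (h1 : F.H1) (hβ : ∀ t ∈ F.Θ, ∀ i, F.β t i ∈ closure F.O)
    (hc : ContinuousOn (fun t => (F.p t, F.β t)) F.Θ) (hG : ∀ y ∈ G, F.IsRegular y)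
    (hθ : θ ∈ F.Θ) {z : S × S} (hz : z ∈ G ×ˢ G) (t : F.Θ) :
    F.logRatio G θ z t = Real.log (F.pairDensity t z.1 z.2 / F.pairDensity θ z.1 z.2) := by
  have hcont : Continuous
      fun t : F.Θ => Real.log (F.pairDensity t z.1 z.2 / F.pairDensity θ z.1 z.2) := by
    have h := continuousOn_iff_continuous_domRestrict.1
      (continuousOn_pairDensity h1 hβ hc (hG _ hz.1) (hG _ hz.2))
    have hd : Continuous fun t : F.Θ => F.pairDensity t z.1 z.2 := h
    refine (hd.div_const _).log fun t => (div_pos ?_ ?_).ne'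
    · exact pairDensity_pos t.2 (hβ t t.2) (hG _ hz.1) (hG _ hz.2)
    · exact pairDensity_pos hθ (hβ θ hθ) (hG _ hz.1) (hG _ hz.2)
  rw [logRatio, if_pos hz, ContinuousMap.mkD_apply_of_continuous hcont]

variable [MeasurableSpace C(F.Θ, ℝ)] [BorelSpace C(F.Θ, ℝ)]

lemma measurable_logRatio (h1 : F.H1) (hβ : ∀ t ∈ F.Θ, ∀ i, F.β t i ∈ closure F.O)
    (hc : ContinuousOn (fun t => (F.p t, F.β t)) F.Θ) (hG : ∀ y ∈ G, F.IsRegular y)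
    (hGm : MeasurableSet G) (hθ : θ ∈ F.Θ) : Measurable (F.logRatio G θ) := by
  classical
  refine measurable_of_eval fun t => ?_
  have : (fun z => F.logRatio G θ z t) = (G ×ˢ G).indicator
      fun z => Real.log (F.pairDensity t z.1 z.2 / F.pairDensity θ z.1 z.2) := by
    ext z
    by_cases hz : z ∈ G ×ˢ G
    · rw [logRatio_apply h1 hβ hc hG hθ hz, Set.indicator_of_mem hz]
    · rw [logRatio, if_neg hz, Set.indicator_of_notMem hz, ContinuousMap.zero_apply]
  rw [this]
  exact (((measurable_pairDensity (hβ t t.2)).div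
    (measurable_pairDensity (hβ θ hθ))).log).indicator (hGm.prod hGm)

/-- The uniform norm of the log-likelihood ratio is at most twice the sum of the oscillations of the
two signals, which is integrable by (H4). -/
lemma integrable_logRatio (h1 : F.H1) (h4 : F.H4) (hβ : ∀ t ∈ F.Θ, ∀ i, F.β t i ∈ closure F.O)
    (hc : ContinuousOn (fun t => (F.p t, F.β t)) F.Θ) (hG : ∀ y ∈ G, F.IsRegular y)
    (hGm : MeasurableSet G) (hθ : θ ∈ F.Θ) {b b' : EuclideanSpace ℝ (Fin d)}
    (hb : b ∈ closure F.O) (hb' : b' ∈ closure F.O) :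
    Integrable (F.logRatio G θ) ((F.signal b).prod (F.signal b')) := by
  have := F.isProbabilityMeasure_signal hb
  have := F.isProbabilityMeasure_signal hb'
  have hm := measurable_logRatio h1 hβ hc hG hGm hθ
  refine ⟨hm.aestronglyMeasurable, ?_⟩
  have hle : ∀ z : S × S, ‖F.logRatio G θ z‖ₑ ≤ 2 * F.logOsc b z.1 + 2 * F.logOsc b' z.2 :=
    fun z => by
    by_cases hfin : F.logOsc b z.1 = ∞
    · simp [hfin]
    by_cases hfin' : F.logOsc b' z.2 = ∞
    · simp [hfin']
    by_cases hz : z ∈ G ×ˢ G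
    · have h : ‖F.logRatio G θ z‖ ≤
          2 * ((F.logOsc b z.1).toReal + (F.logOsc b' z.2).toReal) := by
        refine (ContinuousMap.norm_le _ (by positivity)).2 fun t => ?_
        rw [logRatio_apply h1 hβ hc hG hθ hz, Real.norm_eq_abs]
        exact abs_log_ratio_le hβ t.2 hθ (hG _ hz.1) (hG _ hz.2) hb hb' hfin hfin'
      rw [← ofReal_norm]
      refine (ENNReal.ofReal_le_ofReal h).trans_eq ?_
      rw [ENNReal.ofReal_mul zero_le_two, ENNReal.ofReal_add ENNReal.toReal_nonneg
        ENNReal.toReal_nonneg, ENNReal.ofReal_toReal hfin, ENNReal.ofReal_toReal hfin', mul_add,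
        ENNReal.ofReal_ofNat]
    · rw [← ofReal_norm, logRatio, if_neg hz, norm_zero, ENNReal.ofReal_zero]
      exact zero_le
  have hI : ∀ b ∈ closure F.O, 2 * ∫⁻ y, F.logOsc b y ∂(F.signal b) < ∞ := fun b hb =>
    ENNReal.mul_lt_top (by simp) (h4.integrable_log b hb)
  rw [hasFiniteIntegral_iff_enorm, lintegral_prod _ hm.enorm.aemeasurable]
  calc ∫⁻ y, ∫⁻ y', ‖F.logRatio G θ (y, y')‖ₑ ∂(F.signal b') ∂(F.signal b)
      ≤ ∫⁻ y, (2 * F.logOsc b y + 2 * ∫⁻ y', F.logOsc b' y' ∂(F.signal b')) ∂(F.signal b) := by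
        refine lintegral_mono fun y => (lintegral_mono fun y' => hle (y, y')).trans_eq ?_
        simp only
        rw [lintegral_add_left measurable_const, lintegral_const, measure_univ, mul_one,
          lintegral_const_mul' _ _ (by simp)]
    _ = 2 * ∫⁻ y, F.logOsc b y ∂(F.signal b) + 2 * ∫⁻ y', F.logOsc b' y' ∂(F.signal b') := by
        rw [lintegral_add_right _ measurable_const, lintegral_const, measure_univ, mul_one,
          lintegral_const_mul' _ _ (by simp)]
    _ < ∞ := ENNReal.add_lt_top.2 ⟨hI b hb, hI b' hb'⟩

end LogRatio

end Family

/-! ### Kullback–Leibler divergence and identifiability -/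

/-- If `φ` is a log-likelihood ratio (`∫ exp φ ≤ 1`) with nonnegative mean, then `φ = 0` almost
surely, since `exp φ - 1 - φ` is nonnegative and vanishes only for `φ = 0`. -/
lemma ae_eq_zero_of_lintegral_exp_le_one {α : Type*} [MeasurableSpace α] {μ : Measure α}
    [IsProbabilityMeasure μ] {φ : α → ℝ} (hφ : Integrable φ μ)
    (hexp : ∫⁻ z, ENNReal.ofReal (Real.exp (φ z)) ∂μ ≤ 1) (h0 : 0 ≤ ∫ z, φ z ∂μ) :
    φ =ᵐ[μ] 0 := by
  have hm : AEStronglyMeasurable (fun z => Real.exp (φ z)) μ :=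
    Real.continuous_exp.comp_aestronglyMeasurable hφ.aestronglyMeasurable
  have hnn : 0 ≤ᵐ[μ] fun z => Real.exp (φ z) := ae_of_all _ fun z => (Real.exp_pos _).le
  have hint : Integrable (fun z => Real.exp (φ z)) μ := by
    refine ⟨hm, ?_⟩
    rw [hasFiniteIntegral_iff_ofReal hnn]
    exact hexp.trans_lt ENNReal.one_lt_top
  have h1 : ∫ z, Real.exp (φ z) ∂μ ≤ 1 := by
    rw [integral_eq_lintegral_of_nonneg_ae hnn hm]
    exact ENNReal.toReal_le_of_le_ofReal zero_le_one (by simpa using hexp)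
  have hd : ∫ z, (Real.exp (φ z) - (φ z + 1)) ∂μ = ∫ z, Real.exp (φ z) ∂μ - (∫ z, φ z ∂μ + 1) := by
    refine ((integral_sub hint (hφ.add (integrable_const 1))).trans
      (congrArg (_ - ·) (integral_add hφ (integrable_const 1)))).trans ?_
    simp
  have hd0 : 0 ≤ fun z => Real.exp (φ z) - (φ z + 1) := fun z =>
    sub_nonneg.2 (Real.add_one_le_exp _)
  have hz := (integral_eq_zero_iff_of_nonneg hd0 (hint.sub (hφ.add (integrable_const 1)))).1
    (le_antisymm (by linarith) (integral_nonneg hd0))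
  filter_upwards [hz] with z hz
  by_contra h
  have := Real.add_one_lt_exp h
  simp only [Pi.zero_apply] at hz
  linarith

lemma nnreal_smul_measure_apply {α : Type*} [MeasurableSpace α] (c : ℝ≥0) (μ : Measure α)
    (A : Set α) : (c • μ) A = c * μ A := rfl

section Mixture

variable {α ι κ E : Type*} [MeasurableSpace α] [Fintype ι] [Fintype κ] [NormedAddCommGroup E]
  {f : α → E} {μ : ι → κ → Measure α}

lemma integrable_sum_nnreal_smul (hf : ∀ i j, Integrable f (μ i j)) (c : ι → κ → ℝ≥0) :
    Integrable f (∑ i, ∑ j, c i j • μ i j) :=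
  integrable_finsetSum_measure.2 fun i _ => integrable_finsetSum_measure.2 fun j _ =>
    (hf i j).smul_measure ENNReal.coe_ne_top

lemma integral_sum_nnreal_smul [NormedSpace ℝ E] (hf : ∀ i j, Integrable f (μ i j))
    (c : ι → κ → ℝ≥0) :
    ∫ z, f z ∂(∑ i, ∑ j, c i j • μ i j) = ∑ i, ∑ j, (c i j : ℝ) • ∫ z, f z ∂(μ i j) := by
  have h : ∀ i j, Integrable f (c i j • μ i j) := fun i j =>
    (hf i j).smul_measure ENNReal.coe_ne_top
  rw [integral_finsetSum_measure fun i _ => integrable_finsetSum_measure.2 fun j _ => h i j]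
  refine Finset.sum_congr rfl fun i _ => ?_
  rw [integral_finsetSum_measure fun j _ => h i j]
  exact Finset.sum_congr rfl fun j _ => integral_smul_nnreal_measure f (c i j)

end Mixture

namespace Family

variable {m d M : ℕ} {S : Type*} [MeasurableSpace S] {F : Family m d M S}
  {t θ : EuclideanSpace ℝ (Fin M)}

/-- The stationary probability `μ_t(i) p_ij(t)` of a transition from `i` to `j`. -/
noncomputable def weight (F : Family m d M S) (t : EuclideanSpace ℝ (Fin M)) (i j : Fin m) : ℝ≥0 :=
  (F.invariantLaw t i * F.p t i j).toNNReal

/-- The stationary law of two consecutive signals. -/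
noncomputable def pairLaw (F : Family m d M S) (t : EuclideanSpace ℝ (Fin M)) : Measure (S × S) :=
  ∑ i, ∑ j, F.weight t i j • (F.signal (F.β t i)).prod (F.signal (F.β t j))

lemma pairLaw_apply (A : Set (S × S)) : F.pairLaw t A =
    ∑ i, ∑ j, F.weight t i j * ((F.signal (F.β t i)).prod (F.signal (F.β t j))) A := by
  simp only [pairLaw, Measure.finsetSum_apply, nnreal_smul_measure_apply]

lemma ae_pairLaw_mem {G : Set S} (hβ : ∀ i, F.β t i ∈ closure F.O)
    (hG : ∀ b ∈ closure F.O, ∀ᵐ y ∂(F.signal b), y ∈ G) : ∀ᵐ z ∂(F.pairLaw t), z ∈ G ×ˢ G := by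
  rw [ae_iff, pairLaw_apply]
  refine Finset.sum_eq_zero fun i _ => Finset.sum_eq_zero fun j _ => ?_
  have := F.isProbabilityMeasure_signal (hβ i)
  have := F.isProbabilityMeasure_signal (hβ j)
  have h : ∀ᵐ z ∂((F.signal (F.β t i)).prod (F.signal (F.β t j))), z ∈ G ×ˢ G := by
    filter_upwards [Measure.quasiMeasurePreserving_fst.ae (hG _ (hβ i)),
      Measure.quasiMeasurePreserving_snd.ae (hG _ (hβ j))] with z h1 h2 using ⟨h1, h2⟩
  rw [ae_iff.1 h, mul_zero]

variable [NeZero m]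

lemma coe_weight (ht : t ∈ F.Θ) (i j : Fin m) :
    (F.weight t i j : ℝ) = F.invariantLaw t i * F.p t i j :=
  Real.coe_toNNReal _ (weight_nonneg ht i j)

lemma sum_coe_weight (ht : t ∈ F.Θ) : ∑ i, ∑ j, (F.weight t i j : ℝ≥0∞) = 1 := by
  have h : ∑ i, ∑ j, F.weight t i j = 1 := by
    apply NNReal.coe_injective
    push_cast
    simp only [coe_weight ht, sum_weight ht]
  exact_mod_cast congrArg (fun r : ℝ≥0 => (r : ℝ≥0∞)) h

lemma isProbabilityMeasure_pairLaw (ht : t ∈ F.Θ) (hβ : ∀ i, F.β t i ∈ closure F.O) :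
    IsProbabilityMeasure (F.pairLaw t) := by
  have := fun i => F.isProbabilityMeasure_signal (hβ i)
  refine ⟨?_⟩
  rw [pairLaw_apply]
  simp only [measure_univ, mul_one, sum_coe_weight ht]

lemma pairLaw_eq_withDensity (ht : t ∈ F.Θ) (hβ : ∀ i, F.β t i ∈ closure F.O) :
    F.pairLaw t =
      (F.σ.prod F.σ).withDensity fun z => ENNReal.ofReal (F.pairDensity t z.1 z.2) := by
  have := F.sigmaFinite
  have hq : ∀ i, Measurable fun y => (F.q (F.β t i) y : ℝ≥0∞) := fun i =>
    (F.measurable_q _ (hβ i)).coe_nnreal_ennreal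
  have hd : ∀ i j, Measurable fun z : S × S =>
      (F.q (F.β t i) z.1 : ℝ≥0∞) * (F.q (F.β t j) z.2 : ℝ≥0∞) := fun i j =>
    ((hq i).comp measurable_fst).mul ((hq j).comp measurable_snd)
  have h1 : ∀ z : S × S, ENNReal.ofReal (F.pairDensity t z.1 z.2) = ∑ i, ∑ j,
      F.weight t i j * ((F.q (F.β t i) z.1 : ℝ≥0∞) * (F.q (F.β t j) z.2 : ℝ≥0∞)) := fun z => by
    have h2 : F.pairDensity t z.1 z.2 = ((∑ i, ∑ j,
        F.weight t i j * (F.q (F.β t i) z.1 * F.q (F.β t j) z.2) : ℝ≥0) : ℝ) := by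
      push_cast
      simp only [coe_weight ht, pairDensity, mul_assoc]
    rw [h2, ENNReal.ofReal_coe_nnreal]
    push_cast
    rfl
  ext A hA
  simp only [h1]
  rw [pairLaw_apply, withDensity_apply _ hA, lintegral_finsetSum _ fun i _ =>
    Finset.measurable_sum _ fun j _ => (hd i j).const_mul _]
  refine Finset.sum_congr rfl fun i _ => ?_
  rw [lintegral_finsetSum _ fun j _ => (hd i j).const_mul _]
  refine Finset.sum_congr rfl fun j _ => ?_
  have : SFinite (F.σ.withDensity fun y => (F.q (F.β t j) y : ℝ≥0∞)) := by infer_instance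
  rw [lintegral_const_mul _ (hd i j), signal, signal, prod_withDensity (hq i) (hq j),
    withDensity_apply _ hA]

/-- The strict information inequality: the mean log-likelihood ratio is negative unless the pair
laws coincide. -/
lemma pairLaw_eq_of_integral_nonneg {G : Set S} (h1 : F.H1)
    (hβ : ∀ t ∈ F.Θ, ∀ i, F.β t i ∈ closure F.O)
    (hc : ContinuousOn (fun t => (F.p t, F.β t)) F.Θ) (hG : ∀ y ∈ G, F.IsRegular y)
    (hGae : ∀ b ∈ closure F.O, ∀ᵐ y ∂(F.signal b), y ∈ G)
    (hθ : θ ∈ F.Θ) (t : F.Θ)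
    (hm : Measurable fun z => F.logRatio G θ z t)
    (hint : Integrable (fun z => F.logRatio G θ z t) (F.pairLaw θ))
    (h0 : 0 ≤ ∫ z, F.logRatio G θ z t ∂(F.pairLaw θ)) : F.pairLaw t = F.pairLaw θ := by
  have hprob := isProbabilityMeasure_pairLaw hθ (hβ θ hθ)
  have hprob' := isProbabilityMeasure_pairLaw t.2 (hβ t t.2)
  have hQ : ∀ t ∈ F.Θ, Measurable fun z : S × S => ENNReal.ofReal (F.pairDensity t z.1 z.2) :=
    fun t ht => (measurable_pairDensity (hβ t ht)).ennreal_ofReal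
  have hexp : ∀ z ∈ G ×ˢ G, F.pairDensity θ z.1 z.2 * Real.exp (F.logRatio G θ z t) =
      F.pairDensity t z.1 z.2 := fun z hz => by
    have p := pairDensity_pos hθ (hβ θ hθ) (hG _ hz.1) (hG _ hz.2)
    have p' := pairDensity_pos t.2 (hβ t t.2) (hG _ hz.1) (hG _ hz.2)
    rw [logRatio_apply h1 hβ hc hG hθ hz, Real.exp_log (div_pos p' p), mul_div_cancel₀ _ p.ne']
  have hae : ∀ t ∈ F.Θ, ∀ᵐ z ∂(F.σ.prod F.σ), F.pairDensity t z.1 z.2 ≠ 0 → z ∈ G ×ˢ G :=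
    fun t ht => by
    have h := ae_pairLaw_mem (hβ t ht) hGae
    rw [pairLaw_eq_withDensity ht (hβ t ht), ae_withDensity_iff (hQ t ht)] at h
    filter_upwards [h] with z hz hne
    refine hz fun h => hne ?_
    exact le_antisymm (ENNReal.ofReal_eq_zero.1 h) (pairDensity_nonneg ht _ _)
  have hle : ∫⁻ z, ENNReal.ofReal (Real.exp (F.logRatio G θ z t)) ∂(F.pairLaw θ) ≤ 1 := by
    rw [pairLaw_eq_withDensity hθ (hβ θ hθ),
      lintegral_withDensity_eq_lintegral_mul _ (hQ θ hθ) hm.exp.ennreal_ofReal]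
    calc _ ≤ ∫⁻ z, ENNReal.ofReal (F.pairDensity t z.1 z.2) ∂(F.σ.prod F.σ) := by
          refine lintegral_mono_ae ?_
          filter_upwards [hae θ hθ] with z hz
          rw [Pi.mul_apply, ← ENNReal.ofReal_mul (pairDensity_nonneg hθ _ _)]
          by_cases hne : F.pairDensity θ z.1 z.2 = 0
          · simp [hne]
          · rw [hexp z (hz hne)]
      _ = F.pairLaw t Set.univ := by
          rw [pairLaw_eq_withDensity t.2 (hβ t t.2), withDensity_apply _ MeasurableSet.univ,
            Measure.restrict_univ]
      _ ≤ 1 := by rw [measure_univ]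
  have hzero := ae_eq_zero_of_lintegral_exp_le_one hint hle h0
  rw [pairLaw_eq_withDensity hθ (hβ θ hθ)] at hzero ⊢
  rw [pairLaw_eq_withDensity t.2 (hβ t t.2)]
  refine withDensity_congr_ae ?_
  filter_upwards [hae θ hθ, hae t t.2, (ae_withDensity_iff (hQ θ hθ)).1 hzero] with z a1 a2 a3
  congr 1
  have heq : F.pairDensity θ z.1 z.2 ≠ 0 → F.pairDensity t z.1 z.2 = F.pairDensity θ z.1 z.2 :=
    fun hne => by
    have h3 := a3 fun h =>
      hne (le_antisymm (ENNReal.ofReal_eq_zero.1 h) (pairDensity_nonneg hθ _ _))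
    rw [← hexp z (a1 hne), h3, Pi.zero_apply, Real.exp_zero, mul_one]
  by_cases hne : F.pairDensity θ z.1 z.2 = 0
  · by_contra hne'
    have hz := a2 fun h => hne' (h.trans hne.symm)
    exact (pairDensity_pos hθ (hβ θ hθ) (hG _ hz.1) (hG _ hz.2)).ne' hne
  · exact heq hne

end Family

namespace Family

variable {m d M : ℕ} {S : Type*} [MeasurableSpace S] {F : Family m d M S}
  {t θ : EuclideanSpace ℝ (Fin M)}

lemma H2.injective_beta (h2 : F.H2) (hθ : θ ∈ F.Θ) : Function.Injective (F.β θ) := fun i j hij => by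
  have h := h2 θ hθ θ hθ (Equiv.swap i j) (fun k => by
    rw [Equiv.swap_apply_def]
    split_ifs with h1 h2
    · rw [h1, hij]
    · rw [h2, hij]
    · rfl) i
  rw [Equiv.swap_apply_left] at h
  exact h.symm

lemma sum_smul_dirac_apply {α : Type*} [MeasurableSpace α] [MeasurableSingletonClass α]
    (b : Fin m → α) (c : Fin m → ℝ≥0) (x : α) :
    (∑ i, c i • Measure.dirac (b i)) {x} = ∑ i, (c i : ℝ≥0∞) * ({x} : Set α).indicator 1 (b i) := by
  simp only [Measure.finsetSum_apply, nnreal_smul_measure_apply,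
    Measure.dirac_apply' _ (measurableSet_singleton x)]

lemma sum_smul_dirac_apply_of_injective {α : Type*} [MeasurableSpace α]
    [MeasurableSingletonClass α] {b : Fin m → α} (hb : Function.Injective b) (c : Fin m → ℝ≥0)
    (k : Fin m) : (∑ i, c i • Measure.dirac (b i)) {b k} = c k := by
  rw [sum_smul_dirac_apply, Finset.sum_eq_single k]
  · simp
  · intro i _ hik
    simp [hb.ne hik]
  · simp

/-- Identifiability of mixtures makes the signal distributions of distinct parameters linearly
independent over the nonnegative coefficients. -/
lemma H3.coeff_eq (h3 : F.H3) {b : Fin m → EuclideanSpace ℝ (Fin d)}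
    (hb : Function.Injective b) (hbO : ∀ i, b i ∈ closure F.O) {c c' : Fin m → ℝ≥0}
    (h : ∑ i, c i • F.signal (b i) = ∑ i, c' i • F.signal (b i)) : c = c' := by
  have hprob := fun i => F.isProbabilityMeasure_signal (hbO i)
  have htot : ∑ i, c i = ∑ i, c' i := by
    have := congrArg (fun μ : Measure S => μ Set.univ) h
    simp only [Measure.finsetSum_apply, nnreal_smul_measure_apply, measure_univ,
      mul_one] at this
    exact_mod_cast this
  rcases eq_or_ne (∑ i, c i) 0 with h0 | h0
  · have e1 := Finset.sum_eq_zero_iff.1 h0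
    have e2 := Finset.sum_eq_zero_iff.1 (htot.symm.trans h0)
    ext k
    rw [e1 k (Finset.mem_univ k), e2 k (Finset.mem_univ k)]
  · set s := ∑ i, c i
    have h' := h3 b b (fun i => s⁻¹ * c i) (fun i => s⁻¹ * c' i) hbO hbO
      (by rw [← Finset.mul_sum, inv_mul_cancel₀ h0])
      (by rw [← Finset.mul_sum, ← htot, inv_mul_cancel₀ h0])
      (by simp only [mul_smul, ← Finset.smul_sum, h])
    ext k
    have h5 := congrArg (fun μ => μ {b k}) h'
    simp only [sum_smul_dirac_apply_of_injective hb, ENNReal.coe_inj] at h5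
    rw [mul_left_cancel₀ (inv_ne_zero h0) h5]

lemma pairLaw_prod (hβ : ∀ i, F.β t i ∈ closure F.O) (A B : Set S) : F.pairLaw t (A ×ˢ B) =
    ∑ i, ∑ j, F.weight t i j * (F.signal (F.β t i) A * F.signal (F.β t j) B) := by
  have := fun i => F.isProbabilityMeasure_signal (hβ i)
  simp only [pairLaw_apply, Measure.prod_prod]

variable [NeZero m]

lemma sum_weight_right (ht : t ∈ F.Θ) (i : Fin m) :
    ∑ j, F.weight t i j = (F.invariantLaw t i).toNNReal := by
  apply NNReal.coe_injective
  push_cast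
  simp only [coe_weight ht, ← Finset.mul_sum,
    Matrix.sum_row_of_mem_rowStochastic (F.stochastic t ht), mul_one]
  exact (Real.coe_toNNReal _ ((invariantLaw_spec ht).1.1 i)).symm

/-- The first marginal of the pair law is a mixture of the signal distributions. -/
lemma pairLaw_prod_univ (ht : t ∈ F.Θ) (hβ : ∀ i, F.β t i ∈ closure F.O) (A : Set S) :
    F.pairLaw t (A ×ˢ Set.univ) =
      (∑ i, (F.invariantLaw t i).toNNReal • F.signal (F.β t i)) A := by
  have := fun i => F.isProbabilityMeasure_signal (hβ i)
  rw [pairLaw_prod hβ]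
  simp only [Measure.finsetSum_apply, nnreal_smul_measure_apply, measure_univ, mul_one,
    ← Finset.sum_mul, ← sum_weight_right ht]
  push_cast
  rfl

/-- The first marginal identifies the signal parameters, including their order. -/
lemma beta_eq_of_pairLaw_eq (h1 : F.H1) (h2 : F.H2) (h3 : F.H3)
    (hβ : ∀ t ∈ F.Θ, ∀ i, F.β t i ∈ closure F.O) (ht : t ∈ F.Θ) (hθ : θ ∈ F.Θ)
    (h : F.pairLaw t = F.pairLaw θ) : F.β t = F.β θ := by
  have hsum : ∀ t ∈ F.Θ, ∑ i, (F.invariantLaw t i).toNNReal = 1 := fun t ht => by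
    apply NNReal.coe_injective
    push_cast
    rw [← (invariantLaw_spec ht).1.2]
    exact Finset.sum_congr rfl fun i _ => Real.coe_toNNReal _ ((invariantLaw_spec ht).1.1 i)
  have hmix := h3 (F.β t) (F.β θ) (fun i => (F.invariantLaw t i).toNNReal)
    (fun i => (F.invariantLaw θ i).toNNReal) (hβ t ht) (hβ θ hθ) (hsum t ht) (hsum θ hθ) (by
      ext A _
      rw [← pairLaw_prod_univ ht (hβ t ht), ← pairLaw_prod_univ hθ (hβ θ hθ), h])
  have hex : ∀ k, ∃ i, F.β t i = F.β θ k := fun k => by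
    have h5 := congrArg (fun μ => μ {F.β θ k}) hmix
    simp only [sum_smul_dirac_apply_of_injective (h2.injective_beta hθ)] at h5
    by_contra! hne
    rw [sum_smul_dirac_apply, Finset.sum_eq_zero fun i _ => by simp [hne i]] at h5
    have h6 := h1.invariantLaw_pos hθ k
    rw [eq_comm, ENNReal.coe_eq_zero, Real.toNNReal_eq_zero] at h5
    linarith
  choose τ hτ using hex
  have hτinj : Function.Injective τ := fun k l hkl => h2.injective_beta hθ (by
    rw [← hτ k, ← hτ l, hkl])
  have hid := h2 t ht θ hθ (Equiv.ofBijective τ (Finite.injective_iff_bijective.1 hτinj)) hτ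
  ext1 k
  rw [← hτ k]
  exact congrArg _ (hid k).symm

/-- The pair law identifies the parameter. -/
lemma eq_of_pairLaw_eq (h1 : F.H1) (h2 : F.H2) (h3 : F.H3)
    (hβ : ∀ t ∈ F.Θ, ∀ i, F.β t i ∈ closure F.O)
    (hinj : Set.InjOn (fun t => (F.p t, F.β t)) F.Θ) (ht : t ∈ F.Θ) (hθ : θ ∈ F.Θ)
    (h : F.pairLaw t = F.pairLaw θ) : t = θ := by
  have hb := beta_eq_of_pairLaw_eq h1 h2 h3 hβ ht hθ h
  have hθinj := h2.injective_beta hθ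
  have hprob := fun i => F.isProbabilityMeasure_signal (hβ θ hθ i)
  have hμ : (fun i => (F.invariantLaw t i).toNNReal) = fun i => (F.invariantLaw θ i).toNNReal := by
    refine h3.coeff_eq hθinj (hβ θ hθ) ?_
    ext A _
    rw [← pairLaw_prod_univ hθ (hβ θ hθ), ← hb, ← pairLaw_prod_univ ht (hβ t ht), h]
  -- for fixed `B`, the measure of `A ×ˢ B` is a mixture of signal distributions as a function of `A`
  have hB : ∀ B : Set S, ∀ i, (∑ j, F.weight t i j • F.signal (F.β θ j)) B =
      (∑ j, F.weight θ i j • F.signal (F.β θ j)) B := fun B => by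
    have hc : ∀ t ∈ F.Θ, F.β t = F.β θ → ∀ A, F.pairLaw t (A ×ˢ B) =
        (∑ i, (∑ j, F.weight t i j * (F.signal (F.β θ j) B).toNNReal) • F.signal (F.β θ i)) A :=
      fun t ht hb A => by
      rw [pairLaw_prod (hβ t ht)]
      simp only [Measure.finsetSum_apply, nnreal_smul_measure_apply, hb]
      push_cast
      refine Finset.sum_congr rfl fun i _ => ?_
      rw [Finset.sum_mul]
      refine Finset.sum_congr rfl fun j _ => ?_
      rw [ENNReal.coe_toNNReal (measure_ne_top _ _)]
      ring
    have h5 := h3.coeff_eq hθinj (hβ θ hθ)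
      (c := fun i => ∑ j, F.weight t i j * (F.signal (F.β θ j) B).toNNReal)
      (c' := fun i => ∑ j, F.weight θ i j * (F.signal (F.β θ j) B).toNNReal) (by
        ext A _
        rw [← hc t ht hb, ← hc θ hθ rfl, h])
    intro i
    have h6 := congrArg (fun r : ℝ≥0 => (r : ℝ≥0∞)) (congrFun h5 i)
    push_cast at h6
    simp only [ENNReal.coe_toNNReal (measure_ne_top _ _)] at h6
    simpa only [Measure.finsetSum_apply, nnreal_smul_measure_apply] using h6
  have hw : ∀ i, F.weight t i = F.weight θ i := fun i =>
    h3.coeff_eq hθinj (hβ θ hθ) (Measure.ext fun B _ => hB B i)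
  have hp : F.p t = F.p θ := by
    ext i j
    have e1 : F.invariantLaw t i = F.invariantLaw θ i := by
      have h7 := congrArg NNReal.toReal (congrFun hμ i)
      simpa only [Real.coe_toNNReal _ ((invariantLaw_spec ht).1.1 i),
        Real.coe_toNNReal _ ((invariantLaw_spec hθ).1.1 i)] using h7
    have e2 : F.invariantLaw t i * F.p t i j = F.invariantLaw θ i * F.p θ i j := by
      rw [← coe_weight ht, ← coe_weight hθ, hw]
    rw [e1] at e2
    exact mul_left_cancel₀ (h1.invariantLaw_pos hθ i).ne' e2
  exact hinj ht hθ (Prod.ext hp hb)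

end Family

/-! ### Consistency -/

/-- Maximizers of uniformly convergent continuous functions on a compact space converge to the
unique maximizer of the limit. -/
lemma tendsto_of_isMax {K : Type*} [TopologicalSpace K] [CompactSpace K] {A : ℕ → C(K, ℝ)}
    {L : C(K, ℝ)} (hA : Tendsto A atTop (𝓝 L)) {θ : K} (hL : ∀ s, s ≠ θ → L s < L θ) {t : ℕ → K}
    (ht : ∀ n s, A n s ≤ A n (t n)) : Tendsto t atTop (𝓝 θ) := by
  rw [tendsto_nhds]
  intro U hU hθU
  rcases Uᶜ.eq_empty_or_nonempty with hempty | hne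
  · rw [Set.compl_empty_iff] at hempty
    simp [hempty]
  obtain ⟨s₀, hs₀, hmax⟩ := hU.isClosed_compl.isCompact.exists_isMaxOn hne L.continuous.continuousOn
  have hlt := hL s₀ fun h => hs₀ (h ▸ hθU)
  filter_upwards [Metric.tendsto_nhds.1 hA ((L θ - L s₀) / 2) (by linarith)] with n hn
  by_contra hnU
  have h1 := abs_lt.1 ((ContinuousMap.dist_apply_le_dist (f := A n) (g := L) (t n)).trans_lt hn)
  have h2 := abs_lt.1 ((ContinuousMap.dist_apply_le_dist (f := A n) (g := L) θ).trans_lt hn)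
  have h3 : L (t n) ≤ L s₀ := hmax hnU
  have h4 := ht n θ
  linarith [h1.2, h2.1]

namespace Family

variable {m d M : ℕ} {S : Type*} [MeasurableSpace S] {F : Family m d M S}
  {θ : EuclideanSpace ℝ (Fin M)}

/-- Almost surely no signal lies outside a set of full measure for all signal distributions. -/
lemma IsHMM.ae_mem {ν : Fin m → ℝ} {Ω : Type*} [MeasurableSpace Ω] {ℙ : Measure Ω}
    [IsProbabilityMeasure ℙ] {X : ℕ → Ω → Fin m} {Y : ℕ → Ω → S} (h : F.IsHMM θ ν ℙ X Y)
    {G : Set S} (hGm : MeasurableSet G) (hG : ∀ i, ∀ᵐ y ∂(F.signal (F.β θ i)), y ∈ G) :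
    ∀ᵐ ω ∂ℙ, ∀ k, Y k ω ∈ G := by
  classical
  rw [ae_all_iff]
  intro n
  let A : ℕ → Set S := fun k => if k = n then Gᶜ else Set.univ
  have hA : ∀ k, MeasurableSet (A k) := fun k => by
    by_cases hk : k = n <;> simp [A, hk, hGm]
  have h1 := h.measure_signal_box n hA
  rw [Finset.sum_eq_zero fun x _ => ?_] at h1
  · rw [ae_iff]
    refine measure_mono_null ?_ h1
    intro ω hω k _
    by_cases hk : k = n
    · simpa [A, hk] using hω
    · simp [A, hk]
  · rw [Finset.prod_eq_zero (Finset.mem_univ (Fin.last n)) ?_, zero_mul]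
    have h2 : F.signal (F.β θ (x (Fin.last n))) Gᶜ = 0 := ae_iff.1 (hG (x (Fin.last n)))
    simpa [A] using h2

variable [NeZero m]

/-- Along regular signals the objective is finite. -/
lemma objective_eq_coe (hβ : ∀ t ∈ F.Θ, ∀ i, F.β t i ∈ closure F.O) {y : ℕ → S}
    (hy : ∀ k, F.IsRegular (y k)) {t : EuclideanSpace ℝ (Fin M)} (ht : t ∈ F.Θ) (n : ℕ) :
    F.objective n y t = ((-((n : ℝ)⁻¹ * ∑ k ∈ Finset.range n,
      Real.log (F.pairDensity t (y k) (y (k + 1)))) : ℝ) : EReal) := by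
  have h : ∑ k ∈ Finset.Icc 1 n, ENNReal.log (ENNReal.ofReal (F.pairDensity t (y (k - 1)) (y k))) =
      ((∑ k ∈ Finset.range n, Real.log (F.pairDensity t (y k) (y (k + 1))) : ℝ) : EReal) := by
    induction n with
    | zero => simp
    | succ n ih =>
      rw [Finset.sum_Icc_succ_top (by omega), Finset.sum_range_succ, ih, EReal.coe_add,
        add_tsub_cancel_right, ENNReal.log_ofReal_of_pos (pairDensity_pos ht (hβ t ht) (hy _) (hy _))]
  rw [objective, h, ← EReal.coe_mul, ← EReal.coe_neg]

/-- Maximum entropy estimates are the maximizers over `Θ` of the mean log-likelihood ratio. -/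
lemma isMEE_iff {G : Set S} (h1 : F.H1) (hβ : ∀ t ∈ F.Θ, ∀ i, F.β t i ∈ closure F.O)
    (hc : ContinuousOn (fun t => (F.p t, F.β t)) F.Θ) (hG : ∀ y ∈ G, F.IsRegular y)
    (hθ : θ ∈ F.Θ) {y : ℕ → S} (hy : ∀ k, y k ∈ G) (n : ℕ) {t : EuclideanSpace ℝ (Fin M)}
    (ht : t ∈ F.Θ) :
    F.IsMEE n y t ↔ ∀ s : F.Θ,
      ((n : ℝ)⁻¹ • ∑ k ∈ Finset.range n, F.logRatio G θ (y k, y (k + 1))) s ≤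
      ((n : ℝ)⁻¹ • ∑ k ∈ Finset.range n, F.logRatio G θ (y k, y (k + 1))) ⟨t, ht⟩ := by
  have hreg : ∀ k, F.IsRegular (y k) := fun k => hG _ (hy k)
  have hobj : ∀ s : F.Θ, F.objective n y s =
      ((-((n : ℝ)⁻¹ • ∑ k ∈ Finset.range n, F.logRatio G θ (y k, y (k + 1))) s -
        (n : ℝ)⁻¹ * ∑ k ∈ Finset.range n,
          Real.log (F.pairDensity θ (y k) (y (k + 1))) : ℝ) : EReal) := fun s => by
    rw [objective_eq_coe hβ hreg s.2, ContinuousMap.smul_apply, ContinuousMap.sum_apply,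
      smul_eq_mul, ← neg_add', ← mul_add, ← Finset.sum_add_distrib]
    congr 4 with k
    rw [logRatio_apply h1 hβ hc hG hθ ⟨hy k, hy (k + 1)⟩,
      Real.log_div (pairDensity_pos s.2 (hβ s s.2) (hreg _) (hreg _)).ne'
      (pairDensity_pos hθ (hβ θ hθ) (hreg _) (hreg _)).ne', sub_add_cancel]
  have hiff : ∀ s : F.Θ, F.objective n y t ≤ F.objective n y s ↔
      ((n : ℝ)⁻¹ • ∑ k ∈ Finset.range n, F.logRatio G θ (y k, y (k + 1))) s ≤
      ((n : ℝ)⁻¹ • ∑ k ∈ Finset.range n, F.logRatio G θ (y k, y (k + 1))) ⟨t, ht⟩ := fun s => by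
    rw [hobj ⟨t, ht⟩, hobj s, EReal.coe_le_coe_iff, sub_le_sub_iff_right, neg_le_neg_iff]
  constructor
  · exact fun h s => (hiff s).1 (h.2 s.2)
  · exact fun h => ⟨ht, fun s hs => (hiff ⟨s, hs⟩).2 (h ⟨s, hs⟩)⟩

end Family

end HMM

theorem theorem4p1 {m d M : ℕ} (hm : 2 ≤ m)
    {S : Type*} [TopologicalSpace S] [MeasurableSpace S] [BorelSpace S]
    (hS : HMM.IsSignalSpace S) (F : HMM.Family m d M S)
    (h0 : F.H0) (h1 : F.H1) (h2 : F.H2) (h3 : F.H3) (h4 : F.H4)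
    (θ : EuclideanSpace ℝ (Fin M)) (hθ : θ ∈ F.Θ)
    (ν : Fin m → ℝ) (hν : ν ∈ stdSimplex ℝ (Fin m))
    {Ω : Type*} [MeasurableSpace Ω] (ℙ : Measure Ω) [IsProbabilityMeasure ℙ]
    (X : ℕ → Ω → Fin m) (Y : ℕ → Ω → S) (hXY : F.IsHMM θ ν ℙ X Y) :
    ∀ᵐ ω ∂ℙ,
      (∀ n : ℕ, 1 ≤ n → ∃ t, F.IsMEE n (fun k => Y k ω) t) ∧
      ∀ t : ℕ → EuclideanSpace ℝ (Fin M),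
        (∀ n : ℕ, 1 ≤ n → F.IsMEE n (fun k => Y k ω) (t n)) → Tendsto t atTop (𝓝 θ) := by
  have : NeZero m := ⟨by omega⟩
  have hβ := h0.beta_mem
  have hc := h0.continuousOn
  borelize C(F.Θ, ℝ)
  obtain ⟨G, hGm, hG, hGae⟩ := h4.exists_measurableSet_isRegular (hβ θ hθ 0)
  obtain ⟨N, hN⟩ := h1.exists_pow_pos
  obtain ⟨hμ, hinv⟩ := HMM.Family.invariantLaw_spec hθ
  have hmeas := HMM.Family.measurable_logRatio h1 hβ hc hG hGm hθ
  have hint := fun i j => HMM.Family.integrable_logRatio h1 h4 hβ hc hG hGm hθ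
    (hβ θ hθ i) (hβ θ hθ j)
  have hintP : Integrable (F.logRatio G θ) (F.pairLaw θ) :=
    HMM.integrable_sum_nnreal_smul hint (F.weight θ)
  have hlim : ∑ i, ∑ j, (F.invariantLaw θ i * F.p θ i j) • ∫ z, F.logRatio G θ z
      ∂((F.signal (F.β θ i)).prod (F.signal (F.β θ j))) =
      ∫ z, F.logRatio G θ z ∂(F.pairLaw θ) := by
    rw [HMM.Family.pairLaw, HMM.integral_sum_nnreal_smul hint]
    simp only [HMM.Family.coe_weight hθ]
  have heval : ∀ t : F.Θ, (∫ z, F.logRatio G θ z ∂(F.pairLaw θ)) t =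
      ∫ z, F.logRatio G θ z t ∂(F.pairLaw θ) := fun t => ContinuousMap.integral_apply hintP t
  have hmeval : ∀ t : F.Θ, Measurable fun z => F.logRatio G θ z t := fun t =>
    (continuous_eval_const t).measurable.comp hmeas
  have hieval : ∀ t : F.Θ, Integrable (fun z => F.logRatio G θ z t) (F.pairLaw θ) := fun t =>
    (ContinuousMap.evalCLM ℝ t).integrable_comp hintP
  have hzero : ∀ z, F.logRatio G θ z ⟨θ, hθ⟩ = 0 := fun z => by
    by_cases hz : z ∈ G ×ˢ G
    · rw [HMM.Family.logRatio_apply h1 hβ hc hG hθ hz, div_self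
        (HMM.Family.pairDensity_pos hθ (hβ θ hθ) (hG _ hz.1) (hG _ hz.2)).ne', Real.log_one]
    · rw [HMM.Family.logRatio, if_neg hz, ContinuousMap.zero_apply]
  have hmax : ∀ t : F.Θ, t ≠ ⟨θ, hθ⟩ → (∫ z, F.logRatio G θ z ∂(F.pairLaw θ)) t <
      (∫ z, F.logRatio G θ z ∂(F.pairLaw θ)) ⟨θ, hθ⟩ := fun t hne => by
    rw [heval, heval]
    simp only [hzero, integral_zero]
    by_contra! hnn
    exact hne (Subtype.ext (HMM.Family.eq_of_pairLaw_eq h1 h2 h3 hβ h0.injOn t.2 hθ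
      (HMM.Family.pairLaw_eq_of_integral_nonneg h1 hβ hc hG hGae hθ t (hmeval t) (hieval t) hnn)))
  have hlln := hXY.ae_tendsto_average (F.stochastic θ hθ) hν (hβ θ hθ) (hN θ hθ) hμ hinv hmeas hint
  rw [hlim] at hlln
  filter_upwards [hlln, hXY.ae_mem hGm fun i => hGae _ (hβ θ hθ i)] with ω hω hY
  refine ⟨fun n _ => ?_, fun t ht => ?_⟩
  · obtain ⟨t, -, ht⟩ := isCompact_univ.exists_isMaxOn (Set.nonempty_of_mem (Set.mem_univ
      (⟨θ, hθ⟩ : F.Θ))) ((n : ℝ)⁻¹ • ∑ k ∈ Finset.range n,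
        F.logRatio G θ (Y k ω, Y (k + 1) ω)).continuous.continuousOn
    exact ⟨t, (HMM.Family.isMEE_iff h1 hβ hc hG hθ hY n t.2).2 fun s => ht (Set.mem_univ s)⟩
  · have hmem : ∀ n, t (n + 1) ∈ F.Θ := fun n => (ht (n + 1) (by omega)).1
    have hconv : Tendsto (fun n => (⟨t (n + 1), hmem n⟩ : F.Θ)) atTop (𝓝 ⟨θ, hθ⟩) :=
      HMM.tendsto_of_isMax ((tendsto_add_atTop_iff_nat 1).2 hω) hmax fun n =>
        (HMM.Family.isMEE_iff h1 hβ hc hG hθ hY (n + 1) (hmem n)).1 (ht (n + 1) (by omega))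
    exact (tendsto_add_atTop_iff_nat 1).1 ((continuous_subtype_val.tendsto _).comp hconv)
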